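/- Let $\omega_1>0$ and $\omega_3\in i(0,\infty)$, let $\wp$ be the Weierstrass function of the lattice $2\omega_1\mathbb Z+2\omega_3\mathbb Z$, and let $$V(t,x)=2\wp\big(x+6\wp(\omega_1)t+\omega_3\big)+\wp(\omega_1)$$ be the corresponding cnoidal wave; it is real-valued, and its profile $V(0,\cdot)$ is smooth and $2\omega_1$-periodic. For $\kappa>0$ and $q\in L^\infty(\mathbb R)$ real-valued, let $g(x;\kappa,q)=G(x,x;\kappa,q)$ be the diagonal Green's function, where $G(x,y;\kappa,q)$ is the continuous integral kernel of the resolvent $(-\partial_x^2+q+\kappa^2)^{-1}$ on $L^2(\mathbb R)$ (when it exists). The $H_\kappa$ flow is the equation $$\tfrac{d}{dt}q(t,x)=16\kappa^5 g'(x;\kappa,q(t))+4\kappa^2q'(t,x),\qquad {}'=\partial_x .$$ For every $\kappa>0$ there is a unique $b=b(\kappa)\in(0,\omega_1)$ with $\kappa^2=\wp(b)-\wp(\omega_1)$, and $\wp'(b(\kappa))\neq0$. Put $$\nu(\kappa)=\frac{8\kappa^5}{\wp'(b(\kappa))}+4\kappa^2,\qquad c_1(\kappa)=\frac{\wp(b(\kappa))+\frac12\wp(\omega_1)}{-\wp'(b(\kappa))},\qquad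 c_2(\kappa)=\frac{1}{2\wp'(b(\kappa))}.$$ These are real numbers. For every $\kappa>0$ the following hold. (1) The traveling wave $V_\kappa(t,x)=V(0,x+\nu(\kappa)t)$ is a global classical solution of the $H_\kappa$ flow with initial data $V(0,x)$: it is $C^1$ and bounded, for every $t$ the diagonal Green's function $g(\cdot\,;\kappa,V_\kappa(t))$ exists and is $C^1$, and the equation holds for all $t,x\in\mathbb R$. (2) For all $t,x\in\mathbb R$, $g(x;\kappa,V_\kappa(t))=c_1(\kappa)+c_2(\kappa)V_\kappa(t,x)$. Moreover, as $\kappa\to\infty$ (with implied constants that may depend on $\omega_1,\omega_3$), $$c_1(\kappa)=\frac1{2\kappa}+O(\kappa^{-5}),\qquad c_2(\kappa)=-\frac1{4\kappa^3}+O(\kappa^{-5}).$$ -/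

import Mathlib

open Set MeasureTheory Filter Topology Asymptotics
open scoped ContDiff

/-! ### The Schrödinger operator, its resolvent and its Green's function -/

/-- The (complex) Hilbert space `L²(ℝ)`. -/
abbrev L2R : Type := Lp ℂ 2 (volume : Measure ℝ)

/-- `(-∂² + V + κ²) u = f` in the sense of distributions on `ℝ`, for `u, f ∈ L²(ℝ)`.
For `V ∈ L^∞(ℝ)` every such `u` lies in `H²(ℝ)`, so this is the graph of the usual self-adjoint
operator `-∂² + V + κ²` (domain `H²`, form domain `H¹`). -/
def SchrodingerEq (κ : ℝ) (V : ℝ → ℝ) (u f : L2R) : Prop :=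
  ∀ φ : ℝ → ℝ, ContDiff ℝ ∞ φ → HasCompactSupport φ →
    ∫ x, (-deriv (deriv φ) x + V x * φ x + κ ^ 2 * φ x) • u x = ∫ x, φ x • f x

/-- `R = R(κ, V) = (-∂² + V + κ²)⁻¹`, the resolvent as a bounded operator on `L²(ℝ)`, for
`V ∈ L^∞(ℝ)`: it is inverse to the bijection `-∂² + V + κ²` from its domain onto `L²(ℝ)`. -/
def IsResolvent (κ : ℝ) (V : ℝ → ℝ) (R : L2R →L[ℂ] L2R) : Prop :=
  MemLp V ⊤ (volume : Measure ℝ) ∧ ∀ u f : L2R, R f = u ↔ SchrodingerEq κ V u f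

/-- `G` is the Green's function `G(x, y; κ, V) = ⟨δ_x, R(κ, V) δ_y⟩`: the continuous integral
kernel of the resolvent. -/
def IsGreenFunction (κ : ℝ) (V : ℝ → ℝ) (G : ℝ → ℝ → ℝ) : Prop :=
  Continuous (Function.uncurry G) ∧ (∀ x, MemLp (G x) 2 (volume : Measure ℝ)) ∧
    ∃ R : L2R →L[ℂ] L2R, IsResolvent κ V R ∧
      ∀ f : L2R, (R f : ℝ → ℂ) =ᵐ[volume] fun x => ∫ y, G x y • f y

/-- `g` is the diagonal Green's function `g(x; κ, V) = G(x, x; κ, V)`. -/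
def IsDiagonalGreen (κ : ℝ) (V : ℝ → ℝ) (g : ℝ → ℝ) : Prop :=
  ∃ G : ℝ → ℝ → ℝ, IsGreenFunction κ V G ∧ ∀ x, g x = G x x

/-- The resolvent is determined by `κ` and `V`. -/
theorem IsResolvent.unique {κ : ℝ} {V : ℝ → ℝ} {R S : L2R →L[ℂ] L2R}
    (hR : IsResolvent κ V R) (hS : IsResolvent κ V S) : R = S := by
  ext1 f
  exact (hR.2 _ f).2 ((hS.2 _ f).1 rfl)

/-- The Green's function is determined by `κ` and `V`. -/
theorem IsGreenFunction.unique {κ : ℝ} {V : ℝ → ℝ} {G K : ℝ → ℝ → ℝ}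
    (hG : IsGreenFunction κ V G) (hK : IsGreenFunction κ V K) : G = K := by
  obtain ⟨cG, -, R, hR, eG⟩ := hG
  obtain ⟨cK, -, S, hS, eK⟩ := hK
  obtain rfl := hR.unique hS
  -- the continuous function `x ↦ ∫ H x y φ y dy`
  have cont : ∀ H : ℝ → ℝ → ℝ, Continuous (Function.uncurry H) → ∀ φ : ℝ → ℝ, Continuous φ →
      HasCompactSupport φ → Continuous fun x => ∫ y, φ y • H x y := by
    intro H cH φ cφ sφ
    have h := continuous_parametric_integral_of_continuous (μ := (volume : Measure ℝ))
      (f := fun x y => φ y • H x y) (s := tsupport φ)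
      (by
        have : Continuous fun p : ℝ × ℝ => φ p.2 • H p.1 p.2 :=
          (cφ.comp continuous_snd).smul cH
        exact this) sφ
    refine h.congr fun x => ?_
    refine setIntegral_eq_integral_of_forall_compl_eq_zero fun y hy => ?_
    simp [image_eq_zero_of_notMem_tsupport hy]
  have key : ∀ φ : ℝ → ℝ, ContDiff ℝ ∞ φ → HasCompactSupport φ → ∀ x,
      ∫ y, φ y • G x y = ∫ y, φ y • K x y := by
    intro φ hφ sφ
    have hm : MemLp (fun y => (φ y : ℂ)) 2 (volume : Measure ℝ) :=
      (Complex.continuous_ofReal.comp hφ.continuous).memLp_of_hasCompactSupport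
        (sφ.comp_left Complex.ofReal_zero)
    have hf := hm.coeFn_toLp
    have tr : ∀ (H : ℝ → ℝ → ℝ) (x : ℝ),
        ∫ y, H x y • (hm.toLp _ : ℝ → ℂ) y = ((∫ y, φ y • H x y : ℝ) : ℂ) := by
      intro H x
      rw [← integral_complex_ofReal]
      refine integral_congr_ae ?_
      filter_upwards [hf] with y hy
      simp [hy, mul_comm]
    have hae : (fun x => ∫ y, φ y • G x y) =ᵐ[volume] fun x => ∫ y, φ y • K x y := by
      filter_upwards [eG (hm.toLp _), eK (hm.toLp _)] with x h1 h2
      rw [h1, tr, tr] at h2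
      exact_mod_cast h2
    have := Continuous.ae_eq_iff_eq (volume : Measure ℝ) (cont G cG φ hφ.continuous sφ)
      (cont K cK φ hφ.continuous sφ) |>.1 hae
    exact fun x => congrFun this x
  funext x
  have gx : Continuous (G x) := cG.comp (by fun_prop : Continuous fun y : ℝ => (x, y))
  have kx : Continuous (K x) := cK.comp (by fun_prop : Continuous fun y : ℝ => (x, y))
  refine (Continuous.ae_eq_iff_eq (volume : Measure ℝ) gx kx).1 ?_
  exact ae_eq_of_integral_contDiff_smul_eq gx.locallyIntegrable kx.locallyIntegrable
    fun φ hφ sφ => key φ hφ sφ x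

/-- The diagonal Green's function is determined by `κ` and `V`. -/
theorem IsDiagonalGreen.unique {κ : ℝ} {V : ℝ → ℝ} {g k : ℝ → ℝ}
    (hg : IsDiagonalGreen κ V g) (hk : IsDiagonalGreen κ V k) : g = k := by
  obtain ⟨G, hG, eg⟩ := hg
  obtain ⟨K, hK, ek⟩ := hk
  obtain rfl := hG.unique hK
  funext x
  rw [eg, ek]

/-! ### The `H_κ` flow -/

/-- `q(t, x)` is a (global, classical) solution of the `H_κ` flow
`dq/dt = 16 κ⁵ g'(x; κ, q(t)) + 4 κ² q'(x)`, where `'` is the derivative in `x`. -/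
structure IsHKappaSolution (κ : ℝ) (q : ℝ → ℝ → ℝ) : Prop where
  contDiff : ContDiff ℝ 1 (Function.uncurry q)
  bounded : ∀ T : ℝ, ∃ C : ℝ, ∀ t ∈ Icc (-T) T, ∀ x, |q t x| ≤ C
  evolution : ∀ t : ℝ, ∃ g : ℝ → ℝ, IsDiagonalGreen κ (q t) g ∧ ContDiff ℝ 1 g ∧
    ∀ x, HasDerivAt (fun s => q s x) (16 * κ ^ 5 * deriv g x + 4 * κ ^ 2 * deriv (q t) x) t

/-! ### Cnoidal waves -/

/-- The expression `2 ℘(x + 6 ℘(ω₁) t + ω₃) + ℘(ω₁)`, where `℘` is the Weierstrass function of the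
lattice `L` whose two generators are `2ω₁` and `2ω₃`. -/
noncomputable def cnoidalExpr (L : PeriodPair) (t x : ℝ) : ℂ :=
  2 * L.weierstrassP (x + 6 * L.weierstrassP (L.ω₁ / 2) * t + L.ω₂ / 2)
    + L.weierstrassP (L.ω₁ / 2)

/-- The cnoidal wave `V(t, x)` as a real function. For `ω₁ > 0` and `ω₃ ∈ i(0, ∞)` the expression
is real, so that nothing is lost by taking its real part. -/
noncomputable def cnoidalWave (L : PeriodPair) (t x : ℝ) : ℝ := (cnoidalExpr L t x).re

/-! ### Integral operators with exponentially decaying kernels -/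

section IntegralOperator

open scoped ENNReal

/-! Write $p(x)=\wp(x+\omega_3)$ and $e=\wp(\omega_1)$, so that the profile is $V=2p+e$. Because
$\wp(b)=e+\kappa^2$, the operator $-\partial^2+V+\kappa^2$ is the Lamé operator with potential
$W=2p+\wp(b)$, and the candidate for its diagonal Green's function is $g=(p-\wp(b))/\wp'(b)$, which
is affine in $V$.

The differential equations of $\wp$ give the Ermakov equation $2gg''-g'^2-4Wg^2=-1$. Moreover $g$ is
bounded, and bounded below by a positive constant, since $p\le e<\wp(b)$ and $\wp'(b)<0$
(`RealWeierstrass.isGreenProfile`). The two inequalities rest on a reflection argument for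
$y''=6y^2-\gamma/2$ (`deriv_ne_zero_of_blowup`) and on comparing roots of the Weierstrass cubic
(`RealWeierstrass.p_le`).

Every such $g$ is a diagonal Green's function (`IsGreenProfile.isDiagonalGreen`). The functions
$\sqrt g\,e^{\pm\int 1/(2g)}$ solve $\psi''=W\psi$ with Wronskian $1$; the kernel built from them
decays exponentially, hence is bounded on $L^2$, and is a fundamental solution. Square integrable
weak solutions of the homogeneous equation vanish, so the integral operator is the resolvent.

Finally $g'=c_2V'$ turns the flow into the transport equation with speed
$16\kappa^5c_2+4\kappa^2=\nu$, and the asymptotics follow because $\wp'(b)^2$ is an explicit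
polynomial in $\kappa$. -/

theorem sq_lintegral_mul_le {α : Type*} [MeasurableSpace α] {μ : Measure α} {k f : α → ℝ≥0∞}
    (hk : AEMeasurable k μ) (hf : AEMeasurable f μ) :
    (∫⁻ y, k y * f y ∂μ) ^ (2 : ℝ) ≤ (∫⁻ y, k y ∂μ) * ∫⁻ y, k y * f y ^ (2 : ℝ) ∂μ := by
  -- Cauchy–Schwarz for the splitting $kf=k^{1/2}\cdot(k^{1/2}f)$.
  have h := ENNReal.lintegral_mul_le_Lp_mul_Lq μ Real.HolderConjugate.two_two
    (hk.pow_const (1 / 2 : ℝ)) ((hk.pow_const (1 / 2 : ℝ)).mul hf)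
  have e1 : ∀ a b : ℝ≥0∞, a ^ (1 / 2 : ℝ) * (a ^ (1 / 2 : ℝ) * b) = a * b := fun a b => by
    rw [← mul_assoc, ← ENNReal.rpow_add_of_nonneg _ _ (by norm_num) (by norm_num)]
    norm_num
  have e2 : ∀ a : ℝ≥0∞, (a ^ (1 / 2 : ℝ)) ^ (2 : ℝ) = a := fun a => by
    rw [← ENNReal.rpow_mul]; norm_num
  simp only [Pi.mul_apply, e1, ENNReal.mul_rpow_of_nonneg _ _ (zero_le_two (α := ℝ)), e2] at h
  calc _ ≤ _ := ENNReal.rpow_le_rpow h zero_le_two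
    _ = _ := by rw [ENNReal.mul_rpow_of_nonneg _ _ zero_le_two, e2, e2]

/-- Schur's test. -/
theorem eLpNorm_two_integral_smul_le {E : Type*} [NormedAddCommGroup E] [NormedSpace ℝ E]
    {K : ℝ → ℝ → ℝ} (hK : Continuous (Function.uncurry K)) {A : ℝ≥0∞}
    (h₁ : ∀ x, ∫⁻ y, ‖K x y‖ₑ ≤ A) (h₂ : ∀ y, ∫⁻ x, ‖K x y‖ₑ ≤ A) {f : ℝ → E}
    (hf : AEStronglyMeasurable f) :
    eLpNorm (fun x => ∫ y, K x y • f y) 2 volume ≤ A * eLpNorm f 2 volume := by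
  have hKx : ∀ x, AEMeasurable (fun y => ‖K x y‖ₑ) volume := fun x =>
    (hK.comp (by fun_prop : Continuous fun y : ℝ => (x, y))).measurable.enorm.aemeasurable
  have key : ∫⁻ x, ‖∫ y, K x y • f y‖ₑ ^ (2 : ℝ) ≤ A ^ (2 : ℝ) * ∫⁻ y, ‖f y‖ₑ ^ (2 : ℝ) := by
    calc ∫⁻ x, ‖∫ y, K x y • f y‖ₑ ^ (2 : ℝ)
        ≤ ∫⁻ x, A * ∫⁻ y, ‖K x y‖ₑ * ‖f y‖ₑ ^ (2 : ℝ) := by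
          refine lintegral_mono fun x => ?_
          calc ‖∫ y, K x y • f y‖ₑ ^ (2 : ℝ) ≤ (∫⁻ y, ‖K x y‖ₑ * ‖f y‖ₑ) ^ (2 : ℝ) := by
                refine ENNReal.rpow_le_rpow ?_ zero_le_two
                refine (enorm_integral_le_lintegral_enorm _).trans_eq ?_
                simp only [enorm_smul]
            _ ≤ _ := sq_lintegral_mul_le (hKx x) hf.enorm
            _ ≤ _ := mul_le_mul_left (h₁ x) _
      _ ≤ A * ∫⁻ x, ∫⁻ y, ‖K x y‖ₑ * ‖f y‖ₑ ^ (2 : ℝ) := by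
          rw [lintegral_const_mul'']
          refine AEMeasurable.lintegral_prod_right' (f := fun p : ℝ × ℝ =>
            ‖K p.1 p.2‖ₑ * ‖f p.2‖ₑ ^ (2 : ℝ)) ?_
          exact hK.measurable.enorm.aemeasurable.mul
            ((hf.comp_snd (μ := volume)).enorm.pow_const _)
      _ = A * ∫⁻ y, (∫⁻ x, ‖K x y‖ₑ) * ‖f y‖ₑ ^ (2 : ℝ) := by
          rw [lintegral_lintegral_swap]
          · congr 1
            refine lintegral_congr fun y => ?_
            rw [lintegral_mul_const]
            exact (hK.comp (by fun_prop : Continuous fun x : ℝ => (x, y))).measurable.enorm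
          · exact hK.measurable.enorm.aemeasurable.mul
              ((hf.comp_snd (μ := volume)).enorm.pow_const _)
      _ ≤ A * ∫⁻ y, A * ‖f y‖ₑ ^ (2 : ℝ) := by
          gcongr with y
          exact h₂ y
      _ = A ^ (2 : ℝ) * ∫⁻ y, ‖f y‖ₑ ^ (2 : ℝ) := by
          rw [lintegral_const_mul'' _ (hf.enorm.pow_const _), ← mul_assoc, ENNReal.rpow_two, sq]
  rw [eLpNorm_eq_lintegral_rpow_enorm_toReal two_ne_zero ENNReal.ofNat_ne_top,
    eLpNorm_eq_lintegral_rpow_enorm_toReal two_ne_zero ENNReal.ofNat_ne_top]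
  simp only [ENNReal.toReal_ofNat]
  calc _ ≤ _ := ENNReal.rpow_le_rpow key (by norm_num)
    _ = _ := by
      rw [ENNReal.mul_rpow_of_nonneg _ _ (by norm_num), ← ENNReal.rpow_mul]
      norm_num

theorem integrable_exp_neg_mul_abs {c : ℝ} (hc : 0 < c) :
    Integrable (fun x : ℝ => Real.exp (-c * |x|)) := by
  rw [← integrableOn_univ, ← Iic_union_Ioi (a := (0 : ℝ))]
  refine IntegrableOn.union ?_ ?_
  · refine (integrableOn_exp_mul_Iic hc 0).congr_fun (fun x hx => ?_) measurableSet_Iic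
    simp [abs_of_nonpos (show x ≤ 0 from hx)]
  · refine (integrableOn_exp_mul_Ioi (neg_lt_zero.2 hc) 0).congr_fun (fun x hx => ?_)
      measurableSet_Ioi
    simp [abs_of_pos (show 0 < x from hx)]

theorem memLp_two_exp_neg_mul_abs {c : ℝ} (hc : 0 < c) :
    MemLp (fun x : ℝ => Real.exp (-c * |x|)) 2 volume := by
  rw [memLp_two_iff_integrable_sq (by fun_prop)]
  convert integrable_exp_neg_mul_abs (mul_pos two_pos hc) using 2 with x
  rw [sq, ← Real.exp_add]
  ring_nf

variable {K : ℝ → ℝ → ℝ} {C c : ℝ}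

theorem memLp_of_exp_decay (hK : Continuous (Function.uncurry K)) (hc : 0 < c)
    (hd : ∀ x y, |K x y| ≤ C * Real.exp (-c * |x - y|)) (x : ℝ) : MemLp (K x) 2 volume := by
  have hKx : Continuous (K x) := hK.comp (by fun_prop : Continuous fun y : ℝ => (x, y))
  have hC : 0 ≤ C := by
    have := (abs_nonneg _).trans (hd 0 0)
    simpa using this
  refine ((memLp_two_exp_neg_mul_abs hc).const_mul (C * Real.exp (c * |x|))).mono'
    hKx.aestronglyMeasurable (ae_of_all _ fun y => (hd x y).trans ?_)
  rw [mul_assoc, ← Real.exp_add]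
  gcongr
  have := abs_sub_abs_le_abs_sub y x
  rw [abs_sub_comm] at this
  nlinarith

theorem lintegral_exp_decay_lt_top (hc : 0 < c) :
    ∫⁻ x : ℝ, ‖C * Real.exp (-c * |x|)‖ₑ < ⊤ :=
  ((integrable_exp_neg_mul_abs hc).const_mul C).2

theorem eLpNorm_integral_exp_decay_le {E : Type*} [NormedAddCommGroup E] [NormedSpace ℝ E]
    (hK : Continuous (Function.uncurry K))
    (hd : ∀ x y, |K x y| ≤ C * Real.exp (-c * |x - y|)) {f : ℝ → E}
    (hf : AEStronglyMeasurable f) :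
    eLpNorm (fun x => ∫ y, K x y • f y) 2 volume ≤
      (∫⁻ x : ℝ, ‖C * Real.exp (-c * |x|)‖ₑ) * eLpNorm f 2 volume := by
  have h : ∀ x y, ‖K x y‖ₑ ≤ ‖C * Real.exp (-c * |x - y|)‖ₑ := fun x y => by
    rw [enorm_le_iff_norm_le]
    exact (hd x y).trans (le_abs_self _)
  refine eLpNorm_two_integral_smul_le hK (fun x => ?_) (fun y => ?_) hf
  · refine (lintegral_mono (h x)).trans_eq ?_
    exact lintegral_sub_left_eq_self (fun z => ‖C * Real.exp (-c * |z|)‖ₑ) x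
  · refine (lintegral_mono fun x => h x y).trans_eq ?_
    exact lintegral_sub_right_eq_self (fun z => ‖C * Real.exp (-c * |z|)‖ₑ) y

theorem memLp_integral_exp_decay {E : Type*} [NormedAddCommGroup E] [NormedSpace ℝ E]
    (hK : Continuous (Function.uncurry K)) (hc : 0 < c)
    (hd : ∀ x y, |K x y| ≤ C * Real.exp (-c * |x - y|)) {f : ℝ → E} (hf : MemLp f 2 volume) :
    MemLp (fun x => ∫ y, K x y • f y) 2 volume := by
  refine ⟨?_, (eLpNorm_integral_exp_decay_le hK hd hf.1).trans_lt
    (ENNReal.mul_lt_top (lintegral_exp_decay_lt_top hc) hf.2)⟩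
  exact AEStronglyMeasurable.integral_prod_right' (f := fun p : ℝ × ℝ => K p.1 p.2 • f p.2)
    (hK.aestronglyMeasurable.smul (hf.1.comp_snd (μ := volume)))

theorem integrable_smul_of_memLp {k : ℝ → ℝ} (hk : MemLp k 2 volume) {f : ℝ → ℂ}
    (hf : MemLp f 2 volume) : Integrable (fun y => k y • f y) :=
  memLp_one_iff_integrable.1 (hf.smul (r := 1) hk)

/-- The integral operator on `L²(ℝ)` with a continuous, exponentially decaying kernel. -/
theorem exists_integralOperator (hK : Continuous (Function.uncurry K)) (hc : 0 < c)
    (hd : ∀ x y, |K x y| ≤ C * Real.exp (-c * |x - y|)) :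
    ∃ R : L2R →L[ℂ] L2R, ∀ f : L2R, (R f : ℝ → ℂ) =ᵐ[volume] fun x => ∫ y, K x y • f y := by
  have hm : ∀ f : L2R, MemLp (fun x => ∫ y, K x y • (f : ℝ → ℂ) y) 2 volume := fun f =>
    memLp_integral_exp_decay hK hc hd (Lp.memLp f)
  have hi : ∀ (f : L2R) x, Integrable (fun y => K x y • (f : ℝ → ℂ) y) := fun f x =>
    integrable_smul_of_memLp (memLp_of_exp_decay hK hc hd x) (Lp.memLp f)
  let T : L2R →ₗ[ℂ] L2R :=
    { toFun := fun f => (hm f).toLp _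
      map_add' := fun f g => by
        rw [← MemLp.toLp_add]
        refine MemLp.toLp_congr _ _ (ae_of_all _ fun x => ?_)
        simp only [Pi.add_apply]
        rw [← integral_add (hi f x) (hi g x)]
        refine integral_congr_ae ?_
        filter_upwards [Lp.coeFn_add f g] with y hy
        rw [hy, Pi.add_apply, smul_add]
      map_smul' := fun a f => by
        rw [RingHom.id_apply, ← MemLp.toLp_const_smul]
        refine MemLp.toLp_congr _ _ (ae_of_all _ fun x => ?_)
        simp only [Pi.smul_apply]
        rw [← integral_smul]
        refine integral_congr_ae ?_
        filter_upwards [Lp.coeFn_smul a f] with y hy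
        rw [hy, Pi.smul_apply, smul_comm] }
  refine ⟨T.mkContinuous (∫⁻ x : ℝ, ‖C * Real.exp (-c * |x|)‖ₑ).toReal fun f => ?_,
    fun f => MemLp.coeFn_toLp (hm f)⟩
  change ‖(hm f).toLp _‖ ≤ _
  rw [Lp.norm_toLp, Lp.norm_def, ← ENNReal.toReal_mul]
  exact ENNReal.toReal_mono (ENNReal.mul_ne_top (lintegral_exp_decay_lt_top hc).ne
    (Lp.memLp f).2.ne) (eLpNorm_integral_exp_decay_le hK hd (Lp.memLp f).1)

/-- Fubini's theorem for the integral operator, tested against a compactly supported function. -/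
theorem integral_smul_integral_exp_decay (hK : Continuous (Function.uncurry K)) (hc : 0 < c)
    (hd : ∀ x y, |K x y| ≤ C * Real.exp (-c * |x - y|)) {f : ℝ → ℂ} (hf : MemLp f 2 volume)
    {φ : ℝ → ℝ} (hφ : Continuous φ) (sφ : HasCompactSupport φ) :
    ∫ x, φ x • ∫ y, K x y • f y = ∫ y, (∫ x, K x y * φ x) • f y := by
  have hC : 0 ≤ C := by
    have := (abs_nonneg _).trans (hd 0 0)
    simpa using this
  have hint : Integrable (Function.uncurry fun x y => φ x • (K x y • f y))
      (volume.prod volume) := by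
    -- Since $|x-y|\ge|y|-|x|$, the kernel is dominated by a product of a function of $x$ and one of
    -- $y$. The growing factor $e^{c|x|}$ is harmless on the support of $\varphi$.
    have h1 : Integrable fun x => φ x * (C * Real.exp (c * |x|)) :=
      (by fun_prop : Continuous fun x => φ x * (C * Real.exp (c * |x|))).integrable_of_hasCompactSupport
        sφ.mul_right
    have h2 := integrable_smul_of_memLp (memLp_two_exp_neg_mul_abs hc) hf
    refine (h1.norm.mul_prod h2.norm).mono ?_ (ae_of_all _ fun p => ?_)
    · exact (hφ.comp continuous_fst).aestronglyMeasurable.smul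
        (hK.aestronglyMeasurable.smul (hf.1.comp_snd (μ := volume)))
    · simp only [Function.uncurry, norm_smul, norm_mul, Real.norm_eq_abs, Real.abs_exp, abs_abs, abs_norm,
        abs_of_nonneg hC]
      have h3 : |K p.1 p.2| ≤ C * Real.exp (c * |p.1|) * Real.exp (-c * |p.2|) := by
        refine (hd _ _).trans ?_
        rw [mul_assoc, ← Real.exp_add]
        gcongr
        have := abs_sub_abs_le_abs_sub p.2 p.1
        rw [abs_sub_comm] at this
        nlinarith
      calc |φ p.1| * (|K p.1 p.2| * ‖f p.2‖)
          ≤ |φ p.1| * ((C * Real.exp (c * |p.1|) * Real.exp (-c * |p.2|)) * ‖f p.2‖) := by gcongr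
        _ = _ := by ring
  simp only [← integral_smul]
  rw [integral_integral_swap hint]
  refine integral_congr_ae (ae_of_all _ fun y => ?_)
  simp only
  rw [← integral_smul_const]
  simp only [smul_smul, mul_comm]

end IntegralOperator

/-! ### Green's functions from positive solutions of the Ermakov equation -/

/-- The phase `∫₀ˣ dt / (2 g(t))`. -/
noncomputable def greenPhase (g : ℝ → ℝ) (x : ℝ) : ℝ := ∫ t in (0 : ℝ)..x, 1 / (2 * g t)

/-- The solutions `√g exp(± ∫ 1 / (2g))` of `ψ'' = W ψ`, for the sign `s = ± 1`. -/
noncomputable def jost (g : ℝ → ℝ) (s x : ℝ) : ℝ := √(g x) * Real.exp (s * greenPhase g x)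

/-- The Green's function with the diagonal `g`. -/
noncomputable def greenKernel (g : ℝ → ℝ) (x y : ℝ) : ℝ :=
  √(g x * g y) * Real.exp (-|greenPhase g x - greenPhase g y|)

/-- `g` is a positive, bounded solution of the equation that the diagonal Green's function of
`-∂² + W` satisfies. -/
structure IsGreenProfile (W g : ℝ → ℝ) : Prop where
  contDiff : ContDiff ℝ ∞ g
  lower : ∃ m, 0 < m ∧ ∀ x, m ≤ g x
  upper : ∃ M, ∀ x, g x ≤ M
  deriv_bound : ∃ B, ∀ x, |deriv g x| ≤ B
  ermakov : ∀ x, 2 * g x * deriv (deriv g) x - deriv g x ^ 2 - 4 * W x * g x ^ 2 = -1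

namespace IsGreenProfile

variable {W g : ℝ → ℝ} (h : IsGreenProfile W g)
include h

theorem pos (x : ℝ) : 0 < g x := by
  obtain ⟨m, hm, hg⟩ := h.lower
  exact hm.trans_le (hg x)

theorem hasDerivAt (x : ℝ) : HasDerivAt g (deriv g x) x :=
  (h.contDiff.differentiable (by simp) x).hasDerivAt

theorem contDiff_deriv : ContDiff ℝ ∞ (deriv g) := (contDiff_infty_iff_deriv.1 h.contDiff).2

theorem hasDerivAt_deriv (x : ℝ) : HasDerivAt (deriv g) (deriv (deriv g) x) x :=
  (h.contDiff_deriv.differentiable (by simp) x).hasDerivAt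

theorem contDiff_integrand : ContDiff ℝ ∞ fun t => 1 / (2 * g t) :=
  contDiff_const.div (contDiff_const.mul h.contDiff) fun x => (mul_pos two_pos (h.pos x)).ne'

theorem hasDerivAt_greenPhase (x : ℝ) : HasDerivAt (greenPhase g) (1 / (2 * g x)) x :=
  (h.contDiff_integrand.continuous.integral_hasStrictDerivAt 0 x).hasDerivAt

theorem contDiff_greenPhase : ContDiff ℝ ∞ (greenPhase g) := by
  rw [contDiff_infty_iff_deriv]
  refine ⟨fun x => (h.hasDerivAt_greenPhase x).differentiableAt, ?_⟩
  rw [show deriv (greenPhase g) = _ from funext fun x => (h.hasDerivAt_greenPhase x).deriv]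
  exact h.contDiff_integrand

theorem jost_pos (s x : ℝ) : 0 < jost g s x :=
  mul_pos (Real.sqrt_pos.2 (h.pos x)) (Real.exp_pos _)

theorem contDiff_jost (s : ℝ) : ContDiff ℝ ∞ (jost g s) :=
  (h.contDiff.sqrt fun x => (h.pos x).ne').mul
    (Real.contDiff_exp.comp (contDiff_const.mul h.contDiff_greenPhase))

theorem hasDerivAt_jost (s x : ℝ) :
    HasDerivAt (jost g s) ((deriv g x + s) / (2 * g x) * jost g s x) x := by
  have h1 := ((h.hasDerivAt x).sqrt (h.pos x).ne').mul
    ((h.hasDerivAt_greenPhase x).const_mul s).exp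
  refine h1.congr_deriv ?_
  have hp := Real.sqrt_pos.2 (h.pos x)
  have hs : g x = √(g x) ^ 2 := (Real.sq_sqrt (h.pos x).le).symm
  unfold jost
  generalize Real.exp (s * greenPhase g x) = e
  generalize deriv g x = d
  generalize √(g x) = r at *
  rw [hs]
  field_simp

theorem deriv_jost (s : ℝ) :
    deriv (jost g s) = fun x => (deriv g x + s) / (2 * g x) * jost g s x :=
  funext fun x => (h.hasDerivAt_jost s x).deriv

/-- With the logarithmic derivative $u=(g'+s)/(2g)$ the claim is the Riccati equation $u'+u^2=W$.
Multiplied by $4g^2$ it reads $2gg''-g'^2+s^2=4Wg^2$, which is the Ermakov equation when $s^2=1$. -/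
theorem hasDerivAt_deriv_jost {s : ℝ} (hs : s ^ 2 = 1) (x : ℝ) :
    HasDerivAt (deriv (jost g s)) (W x * jost g s x) x := by
  rw [h.deriv_jost]
  have h1 := (((h.hasDerivAt_deriv x).add_const s).div ((h.hasDerivAt x).const_mul 2)
    (mul_pos two_pos (h.pos x)).ne').mul (h.hasDerivAt_jost s x)
  refine h1.congr_deriv ?_
  have hp := (h.pos x).ne'
  have he := h.ermakov x
  simp only [Pi.div_apply]
  generalize jost g s x = j at *
  generalize deriv (deriv g) x = d2 at *
  generalize deriv g x = d at *
  generalize g x = r at *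
  field_simp
  linear_combination j * he + j * hs

theorem contDiff_deriv_jost (s : ℝ) : ContDiff ℝ ∞ (deriv (jost g s)) :=
  (contDiff_infty_iff_deriv.1 (h.contDiff_jost s)).2

theorem jost_mul_jost (x : ℝ) : jost g (-1) x * jost g 1 x = g x := by
  have hs := Real.mul_self_sqrt (h.pos x).le
  have he : Real.exp (-1 * greenPhase g x) * Real.exp (1 * greenPhase g x) = 1 := by
    rw [← Real.exp_add]; simp
  unfold jost
  linear_combination hs * (Real.exp (-1 * greenPhase g x) * Real.exp (1 * greenPhase g x)) + g x * he

/-- The logarithmic derivatives $(g'\pm1)/(2g)$ differ by $1/g$, and the product of the two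
solutions is $g$. The value $1$ normalizes the jump of the kernel's derivative across the diagonal.
-/
theorem wronskian (x : ℝ) :
    jost g (-1) x * deriv (jost g 1) x - deriv (jost g (-1)) x * jost g 1 x = 1 := by
  have h1 := h.jost_mul_jost x
  have hp := (h.pos x).ne'
  rw [h.deriv_jost, h.deriv_jost]
  field_simp
  linear_combination 2 * h1

theorem greenPhase_monotone : Monotone (greenPhase g) := by
  refine monotone_of_deriv_nonneg
    (fun x => (h.hasDerivAt_greenPhase x).differentiableAt) fun x => ?_
  rw [(h.hasDerivAt_greenPhase x).deriv]
  have := h.pos x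
  positivity

theorem greenKernel_eq_jost {x y : ℝ} (hxy : y ≤ x) :
    greenKernel g x y = jost g (-1) x * jost g 1 y := by
  unfold greenKernel jost
  rw [abs_of_nonneg (sub_nonneg.2 (h.greenPhase_monotone hxy)), Real.sqrt_mul (h.pos x).le,
    mul_mul_mul_comm, ← Real.exp_add]
  ring_nf

omit h in
theorem _root_.greenKernel_comm (g : ℝ → ℝ) (x y : ℝ) : greenKernel g x y = greenKernel g y x := by
  unfold greenKernel
  rw [mul_comm, abs_sub_comm, mul_comm (g x)]
  ring_nf

theorem greenKernel_diag (x : ℝ) : greenKernel g x x = g x := by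
  simp [greenKernel, Real.sqrt_mul_self (h.pos x).le]

omit h in
theorem _root_.greenKernel_nonneg (g : ℝ → ℝ) (x y : ℝ) : 0 ≤ greenKernel g x y := by
  unfold greenKernel; positivity

theorem continuous_greenKernel : Continuous (Function.uncurry (greenKernel g)) := by
  have h1 := h.contDiff.continuous
  have h2 := h.contDiff_greenPhase.continuous
  unfold greenKernel Function.uncurry
  fun_prop

/-- An upper bound $g\le M$ forces the phase to have slope at least $1/(2M)$, which is the decay
rate; it also bounds the prefactor $\sqrt{g(x)g(y)}$ by $M$. -/
theorem greenKernel_decay : ∃ C c : ℝ, 0 < c ∧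
    ∀ x y, |greenKernel g x y| ≤ C * Real.exp (-c * |x - y|) := by
  obtain ⟨M, hM⟩ := h.upper
  have hM0 : 0 < M := (h.pos 0).trans_le (hM 0)
  have hlip : ∀ x y, y ≤ x → 1 / (2 * M) * (x - y) ≤ greenPhase g x - greenPhase g y := by
    intro x y hxy
    refine (convex_univ).mul_sub_le_image_sub_of_le_deriv
      h.contDiff_greenPhase.continuous.continuousOn
      (fun x _ => (h.hasDerivAt_greenPhase x).differentiableAt.differentiableWithinAt)
      (fun z _ => ?_) y (mem_univ _) x (mem_univ _) hxy
    rw [(h.hasDerivAt_greenPhase z).deriv]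
    have := h.pos z
    have := hM z
    gcongr
  have habs : ∀ x y, 1 / (2 * M) * |x - y| ≤ |greenPhase g x - greenPhase g y| := by
    intro x y
    rcases le_total y x with hxy | hxy
    · rw [abs_of_nonneg (sub_nonneg.2 hxy)]
      exact (hlip x y hxy).trans (le_abs_self _)
    · rw [abs_sub_comm x, abs_sub_comm (greenPhase g x), abs_of_nonneg (sub_nonneg.2 hxy)]
      exact (hlip y x hxy).trans (le_abs_self _)
  refine ⟨M, 1 / (2 * M), by positivity, fun x y => ?_⟩
  rw [abs_of_nonneg (greenKernel_nonneg g x y)]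
  unfold greenKernel
  gcongr
  · rw [Real.sqrt_le_left hM0.le, sq]
    exact mul_le_mul (hM x) (hM y) (h.pos y).le hM0.le
  · linarith [habs x y]

/-- Lagrange's identity: a homogeneous solution times $-\varphi''+W\varphi$ is an exact derivative,
so integrals over half-lines reduce to boundary terms. -/
theorem hasDerivAt_jost_mul_sub {s : ℝ} (hs : s ^ 2 = 1) {φ : ℝ → ℝ} (hφ : ContDiff ℝ ∞ φ)
    (x : ℝ) : HasDerivAt (fun x => deriv (jost g s) x * φ x - jost g s x * deriv φ x)
      (jost g s x * (-deriv (deriv φ) x + W x * φ x)) x := by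
  have h1 := (hφ.differentiable (by simp) x).hasDerivAt
  have h2 := ((contDiff_infty_iff_deriv.1 hφ).2.differentiable (by simp) x).hasDerivAt
  refine (((h.hasDerivAt_deriv_jost hs x).mul h1).sub
    ((h.contDiff_jost s).differentiable (by simp) x |>.hasDerivAt.mul h2)).congr_deriv ?_
  ring

theorem contDiff_jost_mul_sub (s : ℝ) {φ : ℝ → ℝ} (hφ : ContDiff ℝ ∞ φ) :
    ContDiff ℝ 1 (fun x => deriv (jost g s) x * φ x - jost g s x * deriv φ x) :=
  (((h.contDiff_deriv_jost s).mul hφ).sub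
    ((h.contDiff_jost s).mul (contDiff_infty_iff_deriv.1 hφ).2)).of_le (by simp)

omit h in
theorem hasCompactSupport_jost_mul_sub (s : ℝ) {φ : ℝ → ℝ} (sφ : HasCompactSupport φ) :
    HasCompactSupport (fun x => deriv (jost g s) x * φ x - jost g s x * deriv φ x) :=
  sφ.mul_left.sub sφ.deriv.mul_left

/-- `greenKernel g` is a fundamental solution of `-∂² + W`. -/
theorem integral_greenKernel_mul (hW : Continuous W) {φ : ℝ → ℝ} (hφ : ContDiff ℝ ∞ φ)
    (sφ : HasCompactSupport φ) (y : ℝ) :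
    ∫ x, greenKernel g x y * (-deriv (deriv φ) x + W x * φ x) = φ y := by
  have hL : Continuous fun x => -deriv (deriv φ) x + W x * φ x := by
    have h2 := (contDiff_infty_iff_deriv.1 (contDiff_infty_iff_deriv.1 hφ).2).2.continuous
    have h1 := hφ.continuous
    fun_prop
  have hK : Continuous fun x => greenKernel g x y :=
    h.continuous_greenKernel.comp (by fun_prop : Continuous fun x : ℝ => (x, y))
  have hint : Integrable fun x => greenKernel g x y * (-deriv (deriv φ) x + W x * φ x) :=
    (hK.mul hL).integrable_of_hasCompactSupport (sφ.deriv.deriv.neg.add sφ.mul_left).mul_left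
  rw [← intervalIntegral.integral_Iic_add_Ioi (b := y) hint.integrableOn hint.integrableOn]
  have e1 := (hasCompactSupport_jost_mul_sub (g := g) 1 sφ).integral_Iic_deriv_eq
    (h.contDiff_jost_mul_sub 1 hφ) y
  have e2 := (hasCompactSupport_jost_mul_sub (g := g) (-1) sφ).integral_Ioi_deriv_eq
    (h.contDiff_jost_mul_sub (-1) hφ) y
  simp only [fun x => (h.hasDerivAt_jost_mul_sub (one_pow 2) hφ x).deriv,
    fun x => (h.hasDerivAt_jost_mul_sub (s := -1) (by norm_num) hφ x).deriv] at e1 e2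
  have i1 : ∫ x in Iic y, greenKernel g x y * (-deriv (deriv φ) x + W x * φ x) =
      jost g (-1) y * ∫ x in Iic y, jost g 1 x * (-deriv (deriv φ) x + W x * φ x) := by
    rw [← integral_const_mul]
    refine setIntegral_congr_fun measurableSet_Iic fun x hx => ?_
    rw [greenKernel_comm, h.greenKernel_eq_jost hx, mul_assoc]
  have i2 : ∫ x in Ioi y, greenKernel g x y * (-deriv (deriv φ) x + W x * φ x) =
      jost g 1 y * ∫ x in Ioi y, jost g (-1) x * (-deriv (deriv φ) x + W x * φ x) := by
    rw [← integral_const_mul]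
    refine setIntegral_congr_fun measurableSet_Ioi fun x hx => ?_
    rw [h.greenKernel_eq_jost (le_of_lt hx)]
    ring
  rw [i1, i2, e1, e2]
  -- In the sum of the boundary terms at $y$ the contributions of $\varphi'$ cancel, and the
  -- Wronskian multiplies $\varphi(y)$.
  linear_combination φ y * h.wronskian y

end IsGreenProfile

/-! ### Solvability for compactly supported data, and uniqueness of weak solutions. -/

theorem hasDerivAt_integral_Iic {k : ℝ → ℝ} (hk : Continuous k) (sk : HasCompactSupport k)
    (x : ℝ) : HasDerivAt (fun x => ∫ y in Iic x, k y) (k x) x := by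
  have hi := hk.integrable_of_hasCompactSupport sk (μ := volume)
  have e : (fun x => ∫ y in Iic x, k y) =
      fun x => (∫ y in Iic 0, k y) + ∫ y in (0 : ℝ)..x, k y := funext fun x => by
    rw [← intervalIntegral.integral_Iic_sub_Iic hi.integrableOn hi.integrableOn]; ring
  rw [e]
  exact (hk.integral_hasStrictDerivAt 0 x).hasDerivAt.const_add _

theorem hasDerivAt_integral_Ioi {k : ℝ → ℝ} (hk : Continuous k) (sk : HasCompactSupport k)
    (x : ℝ) : HasDerivAt (fun x => ∫ y in Ioi x, k y) (-k x) x := by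
  have hi := hk.integrable_of_hasCompactSupport sk (μ := volume)
  have e : (fun x => ∫ y in Ioi x, k y) = fun x => (∫ y, k y) - ∫ y in Iic x, k y :=
    funext fun x => by
      rw [← intervalIntegral.integral_Iic_add_Ioi (b := x) hi.integrableOn hi.integrableOn]; ring
  rw [e]
  exact (hasDerivAt_integral_Iic hk sk x).const_sub _

theorem contDiff_of_hasDerivAt {f f' : ℝ → ℝ} (hf : ∀ x, HasDerivAt f (f' x) x)
    (hf' : ContDiff ℝ ∞ f') : ContDiff ℝ ∞ f := by
  rw [contDiff_infty_iff_deriv]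
  refine ⟨fun x => (hf x).differentiableAt, ?_⟩
  rwa [show deriv f = f' from funext fun x => (hf x).deriv]

namespace IsGreenProfile

variable {W g : ℝ → ℝ} (h : IsGreenProfile W g)
include h

/-- The right side is square integrable by Schur's test, and the left side dominates, up to a
constant, both the solution built in `exists_solution` and its derivative. -/
theorem jost_mul_integral_le {k : ℝ → ℝ} (hk : Continuous k) (sk : HasCompactSupport k) (x : ℝ) :
    jost g (-1) x * |∫ y in Iic x, jost g 1 y * k y| +
      jost g 1 x * |∫ y in Ioi x, jost g (-1) y * k y| ≤ ∫ y, greenKernel g x y • |k y| := by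
  have hKx : Continuous fun y => greenKernel g x y • |k y| :=
    (h.continuous_greenKernel.comp (by fun_prop : Continuous fun y : ℝ => (x, y))).smul hk.abs
  have sa : HasCompactSupport fun y => |k y| := sk.comp_left abs_zero
  have hint := hKx.integrable_of_hasCompactSupport (μ := volume)
    (HasCompactSupport.smul_left (f := greenKernel g x) sa)
  rw [← intervalIntegral.integral_Iic_add_Ioi (b := x) hint.integrableOn hint.integrableOn]
  refine add_le_add ?_ ?_
  · refine (mul_le_mul_of_nonneg_left abs_integral_le_integral_abs
      (h.jost_pos _ x).le).trans_eq ?_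
    rw [← integral_const_mul]
    refine setIntegral_congr_fun measurableSet_Iic fun y hy => ?_
    rw [smul_eq_mul, h.greenKernel_eq_jost hy, abs_mul, abs_of_pos (h.jost_pos _ y), mul_assoc]
  · refine (mul_le_mul_of_nonneg_left abs_integral_le_integral_abs
      (h.jost_pos _ x).le).trans_eq ?_
    rw [← integral_const_mul]
    refine setIntegral_congr_fun measurableSet_Ioi fun y hy => ?_
    rw [smul_eq_mul, greenKernel_comm, h.greenKernel_eq_jost (le_of_lt hy), abs_mul,
      abs_of_pos (h.jost_pos _ y)]
    ring

/-- The equation `-φ'' + W φ = k` has a smooth solution which is square integrable together with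
its derivative. -/
theorem exists_solution {k : ℝ → ℝ} (hk : ContDiff ℝ ∞ k) (sk : HasCompactSupport k) :
    ∃ φ : ℝ → ℝ, ContDiff ℝ ∞ φ ∧ (∀ x, -deriv (deriv φ) x + W x * φ x = k x) ∧
      MemLp φ 2 volume ∧ MemLp (deriv φ) 2 volume := by
  set p := jost g 1 with hp
  set q := jost g (-1) with hq
  have cp : ContDiff ℝ ∞ p := h.contDiff_jost 1
  have cq : ContDiff ℝ ∞ q := h.contDiff_jost (-1)
  have dp : ∀ x, HasDerivAt p (deriv p x) x := fun x => (cp.differentiable (by simp) x).hasDerivAt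
  have dq : ∀ x, HasDerivAt q (deriv q x) x := fun x => (cq.differentiable (by simp) x).hasDerivAt
  have ddp : ∀ x, HasDerivAt (deriv p) (W x * p x) x := h.hasDerivAt_deriv_jost (one_pow 2)
  have ddq : ∀ x, HasDerivAt (deriv q) (W x * q x) x := h.hasDerivAt_deriv_jost (by norm_num)
  have hpk := (cp.mul hk).continuous
  have hqk := (cq.mul hk).continuous
  have spk : HasCompactSupport fun x => p x * k x := sk.mul_left
  have sqk : HasCompactSupport fun x => q x * k x := sk.mul_left
  -- Variation of parameters: $\varphi=qI+pJ$ is the kernel applied to $k$. The terms from $I'$ and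
  -- $J'$ cancel in $\varphi'$, and in $\varphi''$ the Wronskian turns them into $-k$.
  set I : ℝ → ℝ := fun x => ∫ y in Iic x, p y * k y with hI
  set J : ℝ → ℝ := fun x => ∫ y in Ioi x, q y * k y with hJ
  have dI : ∀ x, HasDerivAt I (p x * k x) x := hasDerivAt_integral_Iic hpk spk
  have dJ : ∀ x, HasDerivAt J (-(q x * k x)) x := hasDerivAt_integral_Ioi hqk sqk
  have cI : ContDiff ℝ ∞ I := contDiff_of_hasDerivAt dI (cp.mul hk)
  have cJ : ContDiff ℝ ∞ J := contDiff_of_hasDerivAt dJ (cq.mul hk).neg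
  have dφ : ∀ x, HasDerivAt (fun x => q x * I x + p x * J x)
      (deriv q x * I x + deriv p x * J x) x := fun x =>
    (((dq x).mul (dI x)).add ((dp x).mul (dJ x))).congr_deriv (by ring)
  have eφ : deriv (fun x => q x * I x + p x * J x) =
      fun x => deriv q x * I x + deriv p x * J x := funext fun x => (dφ x).deriv
  have ddφ : ∀ x, HasDerivAt (fun x => deriv q x * I x + deriv p x * J x)
      (W x * (q x * I x + p x * J x) - k x) x := fun x => by
    refine (((ddq x).mul (dI x)).add ((ddp x).mul (dJ x))).congr_deriv ?_
    linear_combination -k x * h.wronskian x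
  have cφ : ContDiff ℝ ∞ fun x => q x * I x + p x * J x := (cq.mul cI).add (cp.mul cJ)
  obtain ⟨C, c, hc, hd⟩ := h.greenKernel_decay
  have sa : HasCompactSupport fun y => |k y| := sk.comp_left abs_zero
  have hkL : MemLp (fun y => |k y|) 2 volume := hk.continuous.abs.memLp_of_hasCompactSupport sa
  have hG : MemLp (fun x => ∫ y, greenKernel g x y • |k y|) 2 volume :=
    memLp_integral_exp_decay h.continuous_greenKernel hc hd hkL
  have bound : ∀ x, q x * |I x| + p x * |J x| ≤ ∫ y, greenKernel g x y • |k y| :=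
    h.jost_mul_integral_le hk.continuous sk
  refine ⟨fun x => q x * I x + p x * J x, cφ, fun x => ?_, ?_, ?_⟩
  · rw [eφ, (ddφ x).deriv]; ring
  · refine hG.mono' cφ.continuous.aestronglyMeasurable (ae_of_all _ fun x => ?_)
    refine le_trans ?_ (bound x)
    refine (abs_add_le _ _).trans_eq ?_
    rw [abs_mul, abs_mul, abs_of_pos (h.jost_pos _ x), abs_of_pos (h.jost_pos _ x)]
  · obtain ⟨m, hm, hgm⟩ := h.lower
    obtain ⟨B, hB⟩ := h.deriv_bound
    have hB0 : 0 ≤ B := (abs_nonneg _).trans (hB 0)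
    -- The logarithmic derivatives $(g'\pm1)/(2g)$ are bounded, so the bound on $\varphi$ passes to
    -- $\varphi'$ at the cost of a constant.
    have hs : ∀ s x, |s| = 1 → |deriv (jost g s) x| ≤ (B + 1) / (2 * m) * jost g s x := by
      intro s x hs
      rw [h.deriv_jost, abs_mul, abs_of_pos (h.jost_pos _ x), abs_div,
        abs_of_pos (mul_pos two_pos (h.pos x))]
      have h1 : |deriv g x + s| ≤ B + 1 := (abs_add_le _ _).trans (by linarith [hB x])
      have h2 := hgm x
      have h3 := (h.jost_pos s x).le
      gcongr
    have cφ' : Continuous fun x => deriv q x * I x + deriv p x * J x := by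
      have := (contDiff_infty_iff_deriv.1 cφ).2.continuous
      rwa [eφ] at this
    rw [eφ]
    refine (hG.const_mul ((B + 1) / (2 * m))).mono' cφ'.aestronglyMeasurable
      (ae_of_all _ fun x => ?_)
    have hK : 0 ≤ (B + 1) / (2 * m) := by positivity
    refine le_trans ?_ (mul_le_mul_of_nonneg_left (bound x) hK)
    refine (abs_add_le _ _).trans ?_
    rw [abs_mul, abs_mul, mul_add, ← mul_assoc, ← mul_assoc]
    exact add_le_add (mul_le_mul_of_nonneg_right (hs (-1) x (by simp)) (abs_nonneg _))
      (mul_le_mul_of_nonneg_right (hs 1 x (by simp)) (abs_nonneg _))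

end IsGreenProfile

theorem exists_smooth_cutoff : ∃ χ : ℝ → ℝ, ContDiff ℝ ∞ χ ∧ HasCompactSupport χ ∧
    ∀ x, |x| ≤ 1 → χ x = 1 := by
  let b : ContDiffBump (0 : ℝ) := ⟨1, 2, one_pos, one_lt_two⟩
  refine ⟨b, b.contDiff, b.hasCompactSupport, fun x hx => ?_⟩
  exact b.one_of_mem_closedBall (by simpa [b] using hx)

theorem exists_abs_le_of_hasCompactSupport {f : ℝ → ℝ} (hf : Continuous f)
    (sf : HasCompactSupport f) : ∃ C, 0 ≤ C ∧ ∀ x, |f x| ≤ C := by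
  obtain ⟨C, hC⟩ := sf.exists_bound_of_continuous hf
  exact ⟨C, (norm_nonneg _).trans (hC 0), hC⟩

namespace IsGreenProfile

variable {W g : ℝ → ℝ} (h : IsGreenProfile W g)
include h

/-- A square integrable weak solution of `-w'' + W w = 0` vanishes. -/
theorem ae_eq_zero_of_weak_solution {w : ℝ → ℂ} (hw : MemLp w 2 volume)
    (hweak : ∀ φ : ℝ → ℝ, ContDiff ℝ ∞ φ → HasCompactSupport φ →
      ∫ x, (-deriv (deriv φ) x + W x * φ x) • w x = 0) : w =ᵐ[volume] 0 := by
  refine ae_eq_zero_of_integral_contDiff_smul_eq_zero (hw.locallyIntegrable (by norm_num))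
    fun k hk sk => ?_
  -- Duality: $\int kw$ vanishes formally because $k=-\varphi''+W\varphi$. As $\varphi$ need not
  -- have compact support, it is replaced by $\chi(\varepsilon x)\varphi(x)$; the commutator terms
  -- carry a factor $\varepsilon$, and they are integrable because $\varphi$, $\varphi'$ and $w$ are
  -- square integrable.
  obtain ⟨φ, cφ, hφ, mφ, mφ'⟩ := h.exists_solution hk sk
  obtain ⟨χ, cχ, sχ, hχ⟩ := exists_smooth_cutoff
  have cχ' := (contDiff_infty_iff_deriv.1 cχ).2
  have cχ'' := (contDiff_infty_iff_deriv.1 cχ').2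
  have cφ' := (contDiff_infty_iff_deriv.1 cφ).2
  obtain ⟨C₁, hC₁, b₁⟩ := exists_abs_le_of_hasCompactSupport cχ'.continuous sχ.deriv
  obtain ⟨C₂, hC₂, b₂⟩ := exists_abs_le_of_hasCompactSupport cχ''.continuous sχ.deriv.deriv
  have i₀ := (integrable_smul_of_memLp mφ hw).norm
  have i₁ := (integrable_smul_of_memLp mφ' hw).norm
  obtain ⟨A, hA⟩ : ∃ A : ℝ, ∀ x, k x ≠ 0 → |x| ≤ A := by
    obtain ⟨A, hA⟩ := sk.isCompact.isBounded.exists_norm_le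
    exact ⟨A, fun x hx => hA x (subset_tsupport _ hx)⟩
  set D : ℝ := 2 * C₁ * (∫ x, ‖deriv φ x • w x‖) + C₂ * ∫ x, ‖φ x • w x‖ with hD
  have hD0 : 0 ≤ D := by positivity
  -- The condition $\varepsilon(|A|+1)\le1$ makes the cutoff equal to $1$ wherever $k\ne0$, and
  -- $\varepsilon\le1$ lets $\varepsilon^2$ be bounded by $\varepsilon$.
  have main : ∀ ε : ℝ, 0 < ε → ε ≤ 1 → ε * (|A| + 1) ≤ 1 → ‖∫ x, k x • w x‖ ≤ ε * D := by
    intro ε hε hε1 hεA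
    have d₁ : ∀ x, HasDerivAt (fun x => χ (ε * x)) (ε * deriv χ (ε * x)) x := fun x => by
      have := (cχ.differentiable (by simp) (ε * x)).hasDerivAt.comp x
        ((hasDerivAt_id x).const_mul ε)
      refine this.congr_deriv ?_
      ring
    have d₂ : ∀ x, HasDerivAt (fun x => deriv χ (ε * x)) (ε * deriv (deriv χ) (ε * x)) x :=
      fun x => by
        have := (cχ'.differentiable (by simp) (ε * x)).hasDerivAt.comp x
          ((hasDerivAt_id x).const_mul ε)
        refine this.congr_deriv ?_
        ring
    have dφ : ∀ x, HasDerivAt φ (deriv φ x) x := fun x =>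
      (cφ.differentiable (by simp) x).hasDerivAt
    have dφ' : ∀ x, HasDerivAt (deriv φ) (deriv (deriv φ) x) x := fun x =>
      (cφ'.differentiable (by simp) x).hasDerivAt
    have e₁ : deriv (fun x => χ (ε * x) * φ x) =
        fun x => ε * deriv χ (ε * x) * φ x + χ (ε * x) * deriv φ x :=
      funext fun x => ((d₁ x).mul (dφ x)).deriv
    have e₂ : ∀ x, deriv (deriv fun x => χ (ε * x) * φ x) x =
        ε * (ε * deriv (deriv χ) (ε * x)) * φ x + ε * deriv χ (ε * x) * deriv φ x +
          (ε * deriv χ (ε * x) * deriv φ x + χ (ε * x) * deriv (deriv φ) x) := fun x => by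
      rw [e₁]
      exact ((((d₂ x).const_mul ε).mul (dφ x)).add ((d₁ x).mul (dφ' x))).deriv
    have cε : ContDiff ℝ ∞ fun x => χ (ε * x) := cχ.comp (contDiff_const.mul contDiff_id)
    have sε : HasCompactSupport fun x => χ (ε * x) :=
      sχ.comp_homeomorph (Homeomorph.mulLeft₀ ε hε.ne')
    have h0 := hweak _ (cε.mul cφ) sε.mul_right
    have hχk : ∀ x, χ (ε * x) * k x = k x := fun x => by
      by_cases hx : k x = 0
      · simp [hx]
      · rw [hχ, one_mul]
        rw [abs_mul, abs_of_pos hε]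
        exact (mul_le_mul_of_nonneg_left ((hA x hx).trans ((le_abs_self A).trans
          (by linarith))) hε.le).trans hεA
    have e₃ : ∀ x, (-deriv (deriv fun x => χ (ε * x) * φ x) x + W x * (χ (ε * x) * φ x)) • w x =
        k x • w x - ((2 * ε * deriv χ (ε * x)) • (deriv φ x • w x) +
          (ε ^ 2 * deriv (deriv χ) (ε * x)) • (φ x • w x)) := fun x => by
      rw [e₂, smul_smul, smul_smul, ← add_smul, ← sub_smul]
      congr 1
      linear_combination χ (ε * x) * hφ x + hχk x
    simp only [e₃] at h0
    have ik : Integrable fun x => k x • w x :=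
      integrable_smul_of_memLp (hk.continuous.memLp_of_hasCompactSupport sk) hw
    have bd : ∀ x, ‖(2 * ε * deriv χ (ε * x)) • (deriv φ x • w x) +
        (ε ^ 2 * deriv (deriv χ) (ε * x)) • (φ x • w x)‖ ≤
          ε * (2 * C₁) * ‖deriv φ x • w x‖ + ε * C₂ * ‖φ x • w x‖ := fun x => by
      refine (norm_add_le _ _).trans (add_le_add ?_ ?_)
      · rw [norm_smul (2 * ε * deriv χ (ε * x))]
        refine mul_le_mul_of_nonneg_right ?_ (norm_nonneg _)
        rw [Real.norm_eq_abs, abs_mul, abs_of_pos (by positivity : 0 < 2 * ε)]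
        nlinarith [b₁ (ε * x)]
      · rw [norm_smul (ε ^ 2 * deriv (deriv χ) (ε * x))]
        refine mul_le_mul_of_nonneg_right ?_ (norm_nonneg _)
        rw [Real.norm_eq_abs, abs_mul, abs_of_pos (by positivity : 0 < ε ^ 2)]
        refine mul_le_mul ?_ (b₂ _) (abs_nonneg _) hε.le
        nlinarith
    have ib : Integrable fun x =>
        ε * (2 * C₁) * ‖deriv φ x • w x‖ + ε * C₂ * ‖φ x • w x‖ :=
      (i₁.const_mul _).add (i₀.const_mul _)
    have ir : Integrable fun x => (2 * ε * deriv χ (ε * x)) • (deriv φ x • w x) +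
        (ε ^ 2 * deriv (deriv χ) (ε * x)) • (φ x • w x) := by
      refine ib.mono' (AEStronglyMeasurable.add ?_ ?_) (ae_of_all _ bd)
      · have : Continuous fun x => 2 * ε * deriv χ (ε * x) := by
          have := cχ'.continuous
          fun_prop
        exact this.aestronglyMeasurable.smul (cφ'.continuous.aestronglyMeasurable.smul hw.1)
      · have : Continuous fun x => ε ^ 2 * deriv (deriv χ) (ε * x) := by
          have := cχ''.continuous
          fun_prop
        exact this.aestronglyMeasurable.smul (cφ.continuous.aestronglyMeasurable.smul hw.1)
    rw [integral_sub ik ir, sub_eq_zero] at h0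
    rw [h0]
    refine (norm_integral_le_of_norm_le ib (ae_of_all _ bd)).trans_eq ?_
    rw [integral_add (i₁.const_mul _) (i₀.const_mul _), integral_const_mul, integral_const_mul]
    ring
  refine norm_le_zero_iff.1 (le_of_forall_pos_le_add fun δ hδ => ?_)
  have hA1 : 0 < |A| + 1 := by positivity
  obtain ⟨ε, hε, hε'⟩ : ∃ ε : ℝ, 0 < ε ∧ ε < min (min 1 (1 / (|A| + 1))) (δ / (D + 1)) :=
    exists_between (by positivity)
  have h1 := (lt_min_iff.1 (lt_min_iff.1 hε').1)
  have h2 := (lt_min_iff.1 hε').2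
  rw [zero_add]
  refine (main ε hε h1.1.le ((lt_div_iff₀ hA1).1 h1.2).le).trans ?_
  rw [lt_div_iff₀ (by positivity)] at h2
  nlinarith

end IsGreenProfile

/-- A positive bounded solution of the Ermakov equation is the diagonal Green's function. -/
theorem IsGreenProfile.isDiagonalGreen {κ : ℝ} {V g : ℝ → ℝ} (hV : Continuous V)
    (bV : ∃ C, ∀ x, |V x| ≤ C) (h : IsGreenProfile (fun x => V x + κ ^ 2) g) :
    IsDiagonalGreen κ V g := by
  obtain ⟨C, c, hc, hd⟩ := h.greenKernel_decay
  have hK := h.continuous_greenKernel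
  have hW : Continuous fun x => V x + κ ^ 2 := hV.add continuous_const
  obtain ⟨R, hR⟩ := exists_integralOperator hK hc hd
  refine ⟨greenKernel g, ⟨hK, memLp_of_exp_decay hK hc hd, R, ⟨?_, ?_⟩, hR⟩,
    fun x => (h.greenKernel_diag x).symm⟩
  · obtain ⟨B, hB⟩ := bV
    exact memLp_top_of_bound hV.aestronglyMeasurable B (ae_of_all _ hB)
  have cont : ∀ φ : ℝ → ℝ, ContDiff ℝ ∞ φ →
      Continuous fun x => -deriv (deriv φ) x + V x * φ x + κ ^ 2 * φ x := fun φ hφ => by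
    have h2 := (contDiff_infty_iff_deriv.1 (contDiff_infty_iff_deriv.1 hφ).2).2.continuous
    have h1 := hφ.continuous
    fun_prop
  have supp : ∀ φ : ℝ → ℝ, HasCompactSupport φ →
      HasCompactSupport fun x => -deriv (deriv φ) x + V x * φ x + κ ^ 2 * φ x := fun φ sφ =>
    (sφ.deriv.deriv.neg.add sφ.mul_left).add sφ.mul_left
  have solves : ∀ f : L2R, SchrodingerEq κ V (R f) f := by
    intro f φ hφ sφ
    calc ∫ x, (-deriv (deriv φ) x + V x * φ x + κ ^ 2 * φ x) • (R f : ℝ → ℂ) x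
        = ∫ x, (-deriv (deriv φ) x + V x * φ x + κ ^ 2 * φ x) •
            ∫ y, greenKernel g x y • (f : ℝ → ℂ) y := by
          refine integral_congr_ae ?_
          filter_upwards [hR f] with x hx
          rw [hx]
      _ = ∫ y, (∫ x, greenKernel g x y *
            (-deriv (deriv φ) x + V x * φ x + κ ^ 2 * φ x)) • (f : ℝ → ℂ) y :=
          integral_smul_integral_exp_decay hK hc hd (Lp.memLp f) (cont φ hφ) (supp φ sφ)
      _ = ∫ x, φ x • (f : ℝ → ℂ) x := by
          congr with y
          rw [← h.integral_greenKernel_mul hW hφ sφ y]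
          simp only [add_mul, add_assoc]
  -- For the converse, `R f - u` is a square integrable weak solution of the homogeneous equation,
  -- hence zero; no regularity of `u` is needed.
  refine fun u f => ⟨fun e => e ▸ solves f, fun hu => ?_⟩
  rw [← sub_eq_zero]
  refine (Lp.eq_zero_iff_ae_eq_zero).2 ?_
  refine h.ae_eq_zero_of_weak_solution (Lp.memLp _) fun φ hφ sφ => ?_
  have hL : MemLp (fun x => -deriv (deriv φ) x + V x * φ x + κ ^ 2 * φ x) 2 volume :=
    (cont φ hφ).memLp_of_hasCompactSupport (supp φ sφ)
  calc ∫ x, (-deriv (deriv φ) x + (V x + κ ^ 2) * φ x) • (R f - u : L2R) x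
      = ∫ x, ((-deriv (deriv φ) x + V x * φ x + κ ^ 2 * φ x) • (R f : ℝ → ℂ) x -
          (-deriv (deriv φ) x + V x * φ x + κ ^ 2 * φ x) • (u : ℝ → ℂ) x) := by
        refine integral_congr_ae ?_
        filter_upwards [Lp.coeFn_sub (R f) u] with x hx
        rw [hx, Pi.sub_apply, smul_sub, add_mul, add_assoc]
    _ = 0 := by
        rw [integral_sub (integrable_smul_of_memLp hL (Lp.memLp _))
          (integrable_smul_of_memLp hL (Lp.memLp _)), solves f φ hφ sφ, hu φ hφ sφ, sub_self]

/-! ### The differential equation of the Weierstrass function -/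

namespace PeriodPair

variable (L : PeriodPair)

theorem hasDerivAt_weierstrassP {z : ℂ} (hz : z ∉ L.lattice) :
    HasDerivAt L.weierstrassP (L.derivWeierstrassP z) z := by
  rw [← L.deriv_weierstrassP]
  exact (L.analyticOnNhd_weierstrassP z hz).differentiableAt.hasDerivAt

/-- Removing the pole term $-2/z^3$ leaves a function analytic at $0$. If $\wp'$ vanished off the
lattice, $z^3$ times that function would equal $2$ near $0$ and yet tend to $0$. -/
theorem exists_derivWeierstrassP_ne_zero : ∃ z, z ∉ L.lattice ∧ L.derivWeierstrassP z ≠ 0 := by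
  by_contra! H
  have h1 : Tendsto (fun z => z ^ 3 * L.derivWeierstrassPExcept 0 z) (𝓝[≠] 0) (𝓝 0) := by
    have : Tendsto (fun z => z ^ 3 * L.derivWeierstrassPExcept 0 z) (𝓝 0)
        (𝓝 (0 ^ 3 * L.derivWeierstrassPExcept 0 0)) :=
      ((continuous_pow 3).continuousAt.mul
        (L.analyticAt_derivWeierstrassPExcept 0).continuousAt).tendsto
    simpa using this.mono_left nhdsWithin_le_nhds
  have hU : ((L.lattice : Set ℂ) \ {0})ᶜ ∈ 𝓝[≠] (0 : ℂ) :=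
    mem_nhdsWithin_of_mem_nhds (L.compl_lattice_sdiff_singleton_mem_nhds 0)
  have h2 : Tendsto (fun z => z ^ 3 * L.derivWeierstrassPExcept 0 z) (𝓝[≠] 0) (𝓝 2) := by
    refine tendsto_const_nhds.congr' ?_
    filter_upwards [hU, self_mem_nhdsWithin] with z hz hz0
    have hzL : z ∉ L.lattice := fun hl => hz ⟨hl, hz0⟩
    have hz0 : z ≠ 0 := hz0
    have := L.derivWeierstrassPExcept_def 0 z
    simp only [ZeroMemClass.coe_zero, sub_zero] at this
    rw [this, H z hzL]
    field_simp
    ring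
  exact two_ne_zero (tendsto_nhds_unique h2 h1)

/-- Differentiating $\wp'^2=4\wp^3-g_2\wp-g_3$ gives $\wp'\,(2\wp''-12\wp^2+g_2)=0$. The complement
of a countable set in the plane is connected, so one of the two analytic factors vanishes
identically, and it is not $\wp'$. -/
theorem hasDerivAt_derivWeierstrassP {z : ℂ} (hz : z ∉ L.lattice) :
    HasDerivAt L.derivWeierstrassP (6 * L.weierstrassP z ^ 2 - L.g₂ / 2) z := by
  have hU : IsOpen ((L.lattice : Set ℂ)ᶜ) := L.isClosed_lattice.isOpen_compl
  have hc : IsPreconnected ((L.lattice : Set ℂ)ᶜ) := by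
    refine (Set.Countable.isConnected_compl_of_one_lt_rank ?_ ?_).isPreconnected
    · rw [Complex.rank_real_complex]; exact Nat.one_lt_ofNat
    · have : Countable L.lattice := L.latticeEquivProd.toEquiv.countable_iff.2 inferInstance
      exact Set.to_countable _
  have hd : ∀ w ∉ L.lattice, HasDerivAt L.derivWeierstrassP (deriv L.derivWeierstrassP w) w :=
    fun w hw => (L.analyticOnNhd_derivWeierstrassP w hw).differentiableAt.hasDerivAt
  have key := AnalyticOnNhd.eq_zero_or_eq_zero_of_mul_eq_zero
    (f := L.derivWeierstrassP)
    (g := fun w => 2 * deriv L.derivWeierstrassP w - (12 * L.weierstrassP w ^ 2 - L.g₂))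
    L.analyticOnNhd_derivWeierstrassP
    ((analyticOnNhd_const.mul L.analyticOnNhd_derivWeierstrassP.deriv).sub
      ((analyticOnNhd_const.mul (L.analyticOnNhd_weierstrassP.pow 2)).sub analyticOnNhd_const))
    (fun w hw => by
      have h1 := (hd w hw).pow 2
      have h2 := (((L.hasDerivAt_weierstrassP hw).pow 3).const_mul 4).sub
        ((L.hasDerivAt_weierstrassP hw).const_mul L.g₂) |>.sub_const L.g₃
      have h3 := h1.unique (h2.congr_of_eventuallyEq (by
        filter_upwards [hU.mem_nhds hw] with v hv
        simpa using L.derivWeierstrassP_sq v hv))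
      simp only [Nat.add_one_sub_one, pow_one, Nat.cast_ofNat] at h3
      linear_combination h3) hc
  rcases key with h0 | h0
  · obtain ⟨w, hw, hne⟩ := L.exists_derivWeierstrassP_ne_zero
    exact absurd (h0 w hw) hne
  · refine (hd z hz).congr_deriv ?_
    linear_combination h0 z hz / 2

/-! ### Complex conjugation -/

section Conj

open ComplexConjugate

variable {L} (hc : ∀ z ∈ L.lattice, conj z ∈ L.lattice)

/-- Complex conjugation on a lattice that is stable under it. -/
noncomputable def conjLattice (hc : ∀ z ∈ L.lattice, conj z ∈ L.lattice) :
    L.lattice ≃ L.lattice where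
  toFun l := ⟨conj l.1, hc _ l.2⟩
  invFun l := ⟨conj l.1, hc _ l.2⟩
  left_inv l := by simp
  right_inv l := by simp

include hc

theorem conj_weierstrassP (z : ℂ) : conj (L.weierstrassP z) = L.weierstrassP (conj z) := by
  rw [weierstrassP, weierstrassP, Complex.conj_tsum, ← (conjLattice hc).tsum_eq]
  congr with l
  simp [conjLattice]

theorem conj_derivWeierstrassP (z : ℂ) :
    conj (L.derivWeierstrassP z) = L.derivWeierstrassP (conj z) := by
  rw [derivWeierstrassP, derivWeierstrassP, map_neg, Complex.conj_tsum,
    ← (conjLattice hc).tsum_eq]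
  refine congrArg Neg.neg (tsum_congr fun l => ?_)
  simp [conjLattice, map_ofNat]

theorem conj_G (n : ℕ) : conj (L.G n) = L.G n := by
  rw [G, Complex.conj_tsum, ← (conjLattice hc).tsum_eq]
  congr with l
  simp [conjLattice]

theorem ofReal_re_g₂ : (L.g₂.re : ℂ) = L.g₂ := by
  rw [← Complex.conj_eq_iff_re, g₂, map_mul, conj_G hc, map_ofNat]

theorem ofReal_re_g₃ : (L.g₃.re : ℂ) = L.g₃ := by
  rw [← Complex.conj_eq_iff_re, g₃, map_mul, conj_G hc, map_ofNat]

variable {a : ℂ} (ha : conj a - a ∈ L.lattice)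
include ha

/-- Conjugation moves $x+a$ by the lattice vector $\bar a-a$, so periodicity makes the value real.
It is used for $a=0$ and for $a=\omega_3$. -/
theorem ofReal_re_weierstrassP (x : ℝ) :
    ((L.weierstrassP (x + a)).re : ℂ) = L.weierstrassP (x + a) := by
  rw [← Complex.conj_eq_iff_re, conj_weierstrassP hc,
    ← L.weierstrassP_add_coe (x + a) ⟨_, ha⟩]
  simp

theorem ofReal_re_derivWeierstrassP (x : ℝ) :
    ((L.derivWeierstrassP (x + a)).re : ℂ) = L.derivWeierstrassP (x + a) := by
  rw [← Complex.conj_eq_iff_re, conj_derivWeierstrassP hc,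
    ← L.derivWeierstrassP_add_coe (x + a) ⟨_, ha⟩]
  simp

omit hc ha in
theorem _root_.HasDerivAt.re_comp_ofReal_add {f : ℂ → ℂ} {f' a : ℂ} {x : ℝ}
    (hf : HasDerivAt f f' (x + a)) : HasDerivAt (fun t : ℝ => (f (t + a)).re) f'.re x :=
  HasDerivAt.real_of_complex (hf.comp_add_const (x : ℂ) a)

omit hc ha in
theorem hasDerivAt_re_weierstrassP {x : ℝ} (hx : x + a ∉ L.lattice) :
    HasDerivAt (fun t : ℝ => (L.weierstrassP (t + a)).re) (L.derivWeierstrassP (x + a)).re x :=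
  (L.hasDerivAt_weierstrassP hx).re_comp_ofReal_add

theorem hasDerivAt_re_derivWeierstrassP {x : ℝ} (hx : x + a ∉ L.lattice) :
    HasDerivAt (fun t : ℝ => (L.derivWeierstrassP (t + a)).re)
      (6 * (L.weierstrassP (x + a)).re ^ 2 - L.g₂.re / 2) x := by
  refine (L.hasDerivAt_derivWeierstrassP hx).re_comp_ofReal_add.congr_deriv ?_
  rw [← ofReal_re_weierstrassP hc ha, ← ofReal_re_g₂ hc]
  norm_cast

theorem re_derivWeierstrassP_sq {x : ℝ} (hx : x + a ∉ L.lattice) :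
    (L.derivWeierstrassP (x + a)).re ^ 2 = 4 * (L.weierstrassP (x + a)).re ^ 3 -
      L.g₂.re * (L.weierstrassP (x + a)).re - L.g₃.re := by
  have := L.derivWeierstrassP_sq _ hx
  rw [← ofReal_re_weierstrassP hc ha, ← ofReal_re_derivWeierstrassP hc ha, ← ofReal_re_g₂ hc,
    ← ofReal_re_g₃ hc] at this
  exact_mod_cast this

end Conj

theorem tendsto_re_weierstrassP_atTop :
    Tendsto (fun x : ℝ => (L.weierstrassP x).re) (𝓝[>] 0) atTop := by
  have h1 : Tendsto (fun x : ℝ => (L.weierstrassPExcept 0 x).re) (𝓝[>] 0) (𝓝 0) := by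
    have h := (L.analyticAt_weierstrassPExcept 0).continuousAt.tendsto
    rw [L.weierstrassPExcept_zero] at h
    have h2 : Tendsto (fun x : ℝ => (x : ℂ)) (𝓝[>] 0) (𝓝 0) :=
      (Complex.continuous_ofReal.tendsto' 0 0 Complex.ofReal_zero).mono_left nhdsWithin_le_nhds
    exact (Complex.continuous_re.tendsto' 0 0 Complex.zero_re).comp (h.comp h2)
  have h2 : Tendsto (fun x : ℝ => (x ^ 2)⁻¹) (𝓝[>] 0) atTop := by
    have := (tendsto_pow_atTop (α := ℝ) two_ne_zero).comp tendsto_inv_nhdsGT_zero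
    refine this.congr fun x => ?_
    simp
  refine (h1.add_atTop h2).congr fun x => ?_
  have := L.weierstrassPExcept_add 0 (x : ℂ)
  rw [← this]
  simp only [ZeroMemClass.coe_zero, sub_zero, Complex.add_re, Complex.sub_re]
  norm_cast
  simp

end PeriodPair

/-! ### Monotonicity of solutions that blow up at the left end. -/

/-- A solution of `y'' = 6y² - γ/2` that blows up at the left end of `(0, 2T)` and has a critical
point in the left half would blow up in the interior, by reflection. -/
theorem deriv_ne_zero_of_blowup {y y' : ℝ → ℝ} {γ T : ℝ}
    (h₁ : ∀ x ∈ Ioo 0 (2 * T), HasDerivAt y (y' x) x)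
    (h₂ : ∀ x ∈ Ioo 0 (2 * T), HasDerivAt y' (6 * y x ^ 2 - γ / 2) x)
    (hy : Tendsto y (𝓝[>] 0) atTop) : ∀ a ∈ Ioo 0 T, y' a ≠ 0 := by
  intro a ha h0
  set v : ℝ × ℝ → ℝ × ℝ := fun p => (p.2, 6 * p.1 ^ 2 - γ / 2) with hv
  have cv : ContDiff ℝ 1 v := by fun_prop
  have hsub : ∀ δ : ℝ, 0 < δ → Icc δ (2 * a - δ) ⊆ Ioo 0 (2 * T) := fun δ hδ t ht =>
    ⟨by linarith [ht.1], by linarith [ht.2, ha.2]⟩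
  -- The autonomous system is invariant under $t\mapsto2a-t$ together with a sign change of $y'$. As
  -- $y'(a)=0$, the solution and its reflection have the same data at $a$.
  have refl : ∀ δ ∈ Ioo 0 a, y δ = y (2 * a - δ) := by
    intro δ hδ
    set f : ℝ → ℝ × ℝ := fun t => (y t, y' t) with hf
    set k : ℝ → ℝ × ℝ := fun t => (y (2 * a - t), -y' (2 * a - t)) with hk
    have df : ∀ t ∈ Icc δ (2 * a - δ), HasDerivAt f (v (f t)) t := fun t ht =>
      (h₁ t (hsub δ hδ.1 ht)).prodMk (h₂ t (hsub δ hδ.1 ht))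
    have dk : ∀ t ∈ Icc δ (2 * a - δ), HasDerivAt k (v (k t)) t := fun t ht => by
      have ht' : 2 * a - t ∈ Icc δ (2 * a - δ) := ⟨by linarith [ht.2], by linarith [ht.1]⟩
      have e1 := (h₁ _ (hsub δ hδ.1 ht')).comp_const_sub (2 * a) t
      have e2 := ((h₂ _ (hsub δ hδ.1 ht')).comp_const_sub (2 * a) t).neg
      rw [neg_neg] at e2
      exact e1.prodMk e2
    have cf : ContinuousOn f (Icc δ (2 * a - δ)) := fun t ht =>
      (df t ht).continuousAt.continuousWithinAt
    have ck : ContinuousOn k (Icc δ (2 * a - δ)) := fun t ht =>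
      (dk t ht).continuousAt.continuousWithinAt
    -- The vector field is only locally Lipschitz, so uniqueness is applied inside a ball containing
    -- both compact trajectories.
    obtain ⟨r₁, hr₁⟩ := isCompact_Icc.exists_bound_of_continuousOn cf
    obtain ⟨r₂, hr₂⟩ := isCompact_Icc.exists_bound_of_continuousOn ck
    obtain ⟨K, hK⟩ := cv.contDiffOn.exists_lipschitzOnWith one_ne_zero
      (convex_closedBall (0 : ℝ × ℝ) (max r₁ r₂)) (isCompact_closedBall _ _)
    have h := ODE_solution_unique_of_mem_Icc (v := fun _ => v)
      (s := fun _ => Metric.closedBall 0 (max r₁ r₂)) (t₀ := a) (fun _ _ => hK)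
      ⟨hδ.2, by linarith [hδ.2]⟩ cf (fun t ht => df t (Ioo_subset_Icc_self ht))
      (fun t ht => by simpa using Or.inl (hr₁ t (Ioo_subset_Icc_self ht))) ck
      (fun t ht => dk t (Ioo_subset_Icc_self ht))
      (fun t ht => by simpa using Or.inr (hr₂ t (Ioo_subset_Icc_self ht)))
      (by simp [hf, hk, h0, two_mul])
    exact congrArg Prod.fst (h (left_mem_Icc.2 (by linarith [hδ.2])))
  -- Since $a<T$, the point $2a$ is interior and $y$ is finite there, against the blow-up at $0$.
  have lim : Tendsto (fun δ => y (2 * a - δ)) (𝓝[>] 0) (𝓝 (y (2 * a))) := by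
    have hc := (h₁ (2 * a) ⟨by linarith [ha.1], by linarith [ha.2]⟩).continuousAt
    refine hc.tendsto.comp ?_
    exact ((continuous_const.sub continuous_id).tendsto' 0 _ (sub_zero _)).mono_left
      nhdsWithin_le_nhds
  refine not_tendsto_nhds_of_tendsto_atTop hy (y (2 * a)) (lim.congr' ?_)
  filter_upwards [Ioo_mem_nhdsGT ha.1] with δ hδ
  exact (refl δ hδ).symm

/-- By Darboux a nonvanishing derivative has constant sign; if it were positive, $y$ would stay
below $y(T/2)$ near $0$. -/
theorem deriv_neg_of_blowup {y y' : ℝ → ℝ} {T : ℝ} (hT : 0 < T)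
    (h₁ : ∀ x ∈ Ioo 0 T, HasDerivAt y (y' x) x) (hne : ∀ x ∈ Ioo 0 T, y' x ≠ 0)
    (hy : Tendsto y (𝓝[>] 0) atTop) : ∀ x ∈ Ioo 0 T, y' x < 0 := by
  refine (hasDerivWithinAt_forall_lt_or_forall_gt_of_forall_ne (convex_Ioo 0 T)
    (fun x hx => (h₁ x hx).hasDerivWithinAt) hne).resolve_right fun hpos => ?_
  have hmono : StrictMonoOn y (Ioo 0 T) := by
    refine strictMonoOn_of_deriv_pos (convex_Ioo 0 T)
      (fun x hx => (h₁ x hx).continuousAt.continuousWithinAt) fun x hx => ?_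
    rw [interior_Ioo] at hx
    rw [(h₁ x hx).deriv]
    exact hpos x hx
  have hm : T / 2 ∈ Ioo 0 T := ⟨by linarith, by linarith⟩
  obtain ⟨x, hx1, hx2⟩ := ((hy.eventually_gt_atTop (y (T / 2))).and
    (Ioo_mem_nhdsGT hm.1)).exists
  exact (hmono ⟨hx2.1, by linarith [hx2.2]⟩ hm hx2.2).not_gt hx1

theorem IsGreenProfile.comp_add_const {W g : ℝ → ℝ} (h : IsGreenProfile W g) (s : ℝ) :
    IsGreenProfile (fun x => W (x + s)) fun x => g (x + s) := by
  have e₁ : (deriv fun x => g (x + s)) = fun x => deriv g (x + s) :=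
    funext fun x => deriv_comp_add_const g s x
  obtain ⟨m, hm, hgm⟩ := h.lower
  obtain ⟨M, hM⟩ := h.upper
  obtain ⟨B, hB⟩ := h.deriv_bound
  refine ⟨h.contDiff.comp (contDiff_id.add contDiff_const), ⟨m, hm, fun x => hgm _⟩,
    ⟨M, fun x => hM _⟩, ⟨B, fun x => ?_⟩, fun x => ?_⟩
  · rw [e₁]; exact hB _
  · rw [e₁, deriv_comp_add_const]; exact h.ermakov _

theorem Function.Periodic.exists_abs_le {f : ℝ → ℝ} {T : ℝ} (hf : Function.Periodic f T)
    (hT : 0 < T) (cf : Continuous f) : ∃ C, ∀ x, |f x| ≤ C := by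
  obtain ⟨C, hC⟩ := isCompact_Icc.exists_bound_of_continuousOn (s := Icc 0 T) cf.continuousOn
  refine ⟨C, fun x => ?_⟩
  obtain ⟨y, hy, e⟩ := hf.exists_mem_Ico₀ hT x
  rw [e]
  exact hC y (Ico_subset_Icc_self hy)

/-! ### Real-variable consequences of the Weierstrass equations. -/

/-- The restrictions `y` and `p` of a Weierstrass function of a rectangular lattice with half
period `T` to the real line and to its translate by the imaginary half period. -/
structure RealWeierstrass (T γ₂ γ₃ : ℝ) (y y' p p' : ℝ → ℝ) : Prop where
  pos : 0 < T
  hasDerivAt_y : ∀ x ∈ Ioo 0 (2 * T), HasDerivAt y (y' x) x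
  hasDerivAt_y' : ∀ x ∈ Ioo 0 (2 * T), HasDerivAt y' (6 * y x ^ 2 - γ₂ / 2) x
  y'_sq : ∀ x ∈ Ioo 0 (2 * T), y' x ^ 2 = 4 * y x ^ 3 - γ₂ * y x - γ₃
  y_atTop : Tendsto y (𝓝[>] 0) atTop
  y'_half : y' T = 0
  hasDerivAt_p : ∀ x, HasDerivAt p (p' x) x
  hasDerivAt_p' : ∀ x, HasDerivAt p' (6 * p x ^ 2 - γ₂ / 2) x
  p'_sq : ∀ x, p' x ^ 2 = 4 * p x ^ 3 - γ₂ * p x - γ₃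
  periodic : Function.Periodic p (2 * T)

namespace RealWeierstrass

variable {T γ₂ γ₃ : ℝ} {y y' p p' : ℝ → ℝ} (h : RealWeierstrass T γ₂ γ₃ y y' p p')
include h

theorem Ioo_subset : Ioo 0 T ⊆ Ioo 0 (2 * T) :=
  Ioo_subset_Ioo_right (by linarith [h.pos])

theorem half_mem : T ∈ Ioo 0 (2 * T) := ⟨h.pos, by linarith [h.pos]⟩

theorem y'_neg : ∀ x ∈ Ioo 0 T, y' x < 0 :=
  deriv_neg_of_blowup h.pos (fun x hx => h.hasDerivAt_y x (h.Ioo_subset hx))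
    (deriv_ne_zero_of_blowup h.hasDerivAt_y h.hasDerivAt_y' h.y_atTop) h.y_atTop

theorem strictAntiOn : StrictAntiOn y (Ioc 0 T) := by
  have hs : Ioc 0 T ⊆ Ioo 0 (2 * T) := fun x hx => ⟨hx.1, by linarith [hx.2, h.pos]⟩
  refine strictAntiOn_of_deriv_neg (convex_Ioc 0 T)
    (fun x hx => (h.hasDerivAt_y x (hs hx)).continuousAt.continuousWithinAt) fun x hx => ?_
  rw [interior_Ioc] at hx
  rw [(h.hasDerivAt_y x (h.Ioo_subset hx)).deriv]
  exact h.y'_neg x hx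

theorem exists_eq {c : ℝ} (hc : y T < c) : ∃ b ∈ Ioo 0 T, y b = c := by
  obtain ⟨a, ha, ha'⟩ := ((h.y_atTop.eventually_ge_atTop c).and (Ioo_mem_nhdsGT h.pos)).exists
  have cont : ContinuousOn y (Icc a T) := fun x hx =>
    (h.hasDerivAt_y x ⟨ha'.1.trans_le hx.1, by linarith [hx.2, h.pos]⟩).continuousAt.continuousWithinAt
  obtain ⟨b, hb, e⟩ := intermediate_value_Icc' ha'.2.le cont ⟨hc.le, ha⟩
  refine ⟨b, ⟨ha'.1.trans_le hb.1, lt_of_le_of_ne hb.2 ?_⟩, e⟩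
  rintro rfl
  exact hc.ne e

theorem existsUnique_eq {c : ℝ} (hc : y T < c) :
    ∃ b ∈ Ioo 0 T, y b = c ∧ ∀ b' ∈ Ioo 0 T, y b' = c → b' = b := by
  obtain ⟨b, hb, e⟩ := h.exists_eq hc
  exact ⟨b, hb, e, fun b' hb' e' => h.strictAntiOn.injOn (Ioo_subset_Ioc_self hb')
    (Ioo_subset_Ioc_self hb) (e'.trans e.symm)⟩

/-- Bootstrapping: the first order system for $(p,p')$ gains one derivative at each step. -/
theorem contDiff_p : ContDiff ℝ ∞ p := by
  have key : ∀ n : ℕ, ContDiff ℝ n p ∧ ContDiff ℝ n p' := by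
    intro n
    induction n with
    | zero =>
      simp only [CharP.cast_eq_zero, contDiff_zero]
      exact ⟨continuous_iff_continuousAt.2 fun x => (h.hasDerivAt_p x).continuousAt,
        continuous_iff_continuousAt.2 fun x => (h.hasDerivAt_p' x).continuousAt⟩
    | succ n ih =>
      have e₁ : deriv p = p' := funext fun x => (h.hasDerivAt_p x).deriv
      have e₂ : deriv p' = fun x => 6 * p x ^ 2 - γ₂ / 2 :=
        funext fun x => (h.hasDerivAt_p' x).deriv
      push_cast
      rw [contDiff_succ_iff_deriv, contDiff_succ_iff_deriv, e₁, e₂]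
      exact ⟨⟨fun x => (h.hasDerivAt_p x).differentiableAt, by simp, ih.2⟩,
        fun x => (h.hasDerivAt_p' x).differentiableAt, by simp,
        (contDiff_const.mul (ih.1.pow 2)).sub contDiff_const⟩
  exact contDiff_infty.2 fun n => (key n).1

theorem exists_abs_p_le : ∃ C, ∀ x, |p x| ≤ C :=
  h.periodic.exists_abs_le (mul_pos two_pos h.pos) h.contDiff_p.continuous

theorem deriv_p : deriv p = p' := funext fun x => (h.hasDerivAt_p x).deriv

theorem exists_abs_p'_le : ∃ C, ∀ x, |p' x| ≤ C := by
  refine Function.Periodic.exists_abs_le (T := 2 * T) (fun x => ?_) (mul_pos two_pos h.pos) ?_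
  · rw [← h.deriv_p, ← deriv_comp_add_const p]
    congr 1
    exact funext h.periodic
  · rw [← h.deriv_p]
    exact (contDiff_infty_iff_deriv.1 h.contDiff_p).2.continuous

/-- The values of the Weierstrass function on the translated line are at most its value at the
real half period. -/
theorem p_le (x : ℝ) : p x ≤ y T := by
  -- At a maximum $z$ of $p$ one has $p'(z)=0$, so $p(z)$ is a root of the cubic
  -- $4X^3-\gamma_2X-\gamma_3$. A value above $y(T)$ would also be $y(b)$ for some $b\in(0,T)$,
  -- where the cubic equals $y'(b)^2\ne0$.
  obtain ⟨z, -, hz⟩ := isCompact_Icc.exists_isMaxOn (s := Icc 0 (2 * T))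
    (nonempty_Icc.2 (mul_pos two_pos h.pos).le) h.contDiff_p.continuous.continuousOn
  have hmax : ∀ x, p x ≤ p z := fun x => by
    obtain ⟨w, hw, e⟩ := h.periodic.exists_mem_Ico₀ (mul_pos two_pos h.pos) x
    rw [e]
    exact hz (Ico_subset_Icc_self hw)
  have h0 : p' z = 0 :=
    IsLocalMax.hasDerivAt_eq_zero (Eventually.of_forall hmax) (h.hasDerivAt_p z)
  refine (hmax x).trans (not_lt.1 fun hlt => ?_)
  obtain ⟨b, hb, e⟩ := h.exists_eq hlt
  have h1 := h.y'_sq b (h.Ioo_subset hb)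
  rw [e, ← h.p'_sq z, h0] at h1
  exact (h.y'_neg b hb).ne (by simpa using h1)

/-- With $\beta=y(b)$ and $P(X)=4X^3-\gamma_2X-\gamma_3$, the Ermakov equation reduces to the
identity $2(p-\beta)(6p^2-\gamma_2/2)-P(p)-4(2p+\beta)(p-\beta)^2=-P(\beta)$, where
$P(\beta)=y'(b)^2$. The lower bound $-\kappa^2/y'(b)$ comes from $p\le y(T)=\beta-\kappa^2$ and
$y'(b)<0$. -/
theorem isGreenProfile {κ b : ℝ} (hκ : 0 < κ) (hb : b ∈ Ioo 0 T) (e : y b = y T + κ ^ 2) :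
    IsGreenProfile (fun x => 2 * p x + y T + κ ^ 2) fun x => (p x - y b) / y' b := by
  have hneg := h.y'_neg b hb
  have d₁ : ∀ x, HasDerivAt (fun x => (p x - y b) / y' b) (p' x / y' b) x := fun x =>
    ((h.hasDerivAt_p x).sub_const _).div_const _
  have e₁ : (deriv fun x => (p x - y b) / y' b) = fun x => p' x / y' b :=
    funext fun x => (d₁ x).deriv
  obtain ⟨C, hC⟩ := h.exists_abs_p_le
  obtain ⟨B, hB⟩ := h.exists_abs_p'_le
  refine ⟨(h.contDiff_p.sub contDiff_const).div_const _, ⟨-κ ^ 2 / y' b, ?_, fun x => ?_⟩,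
    ⟨(-C - y b) / y' b, fun x => ?_⟩, ⟨B / |y' b|, fun x => ?_⟩, fun x => ?_⟩
  · exact div_pos_of_neg_of_neg (neg_lt_zero.2 (by positivity)) hneg
  · exact div_le_div_of_nonpos_of_le hneg.le (by linarith [h.p_le x])
  · exact div_le_div_of_nonpos_of_le hneg.le (by linarith [(abs_le.1 (hC x)).1])
  · rw [e₁, abs_div]
    gcongr
    exact hB x
  · rw [e₁, ((h.hasDerivAt_p' x).div_const _).deriv]
    have h1 := h.y'_sq b (h.Ioo_subset hb)
    have h2 := h.p'_sq x
    have h3 : y T + κ ^ 2 = y b := e.symm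
    rw [add_assoc, h3]
    field_simp [hneg.ne]
    linear_combination -h2 + h1

/-- Taylor expansion of the cubic at its root $y(T)$, with increment $\kappa^2$. -/
theorem y'_sq_eq {κ b : ℝ} (hb : b ∈ Ioo 0 T) (e : y b = y T + κ ^ 2) :
    y' b ^ 2 = 4 * κ ^ 2 * (κ ^ 4 + 3 * y T * κ ^ 2 + (3 * y T ^ 2 - γ₂ / 4)) := by
  have h1 := h.y'_sq b (h.Ioo_subset hb)
  have h2 := h.y'_sq T h.half_mem
  rw [h.y'_half] at h2
  rw [h1, e]
  linear_combination -h2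

end RealWeierstrass

/-! ### Asymptotics -/

section Asymptotics

variable {D : ℝ → ℝ} {e A : ℝ} (hD : ∀ κ : ℝ, 0 < κ → 0 < D κ)
  (hsq : ∀ κ : ℝ, 0 < κ → D κ ^ 2 = 4 * κ ^ 2 * (κ ^ 4 + 3 * e * κ ^ 2 + A))
include hD hsq

/-- In truth $D\sim2\kappa^3$; this weaker bound is enough for the denominators below. The threshold
on $\kappa$ makes $D^2-\kappa^6=\kappa^2(3\kappa^4+12e\kappa^2+4A)$ nonnegative. -/
theorem eventually_cube_le : ∀ᶠ κ : ℝ in atTop, κ ^ 3 ≤ D κ := by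
  filter_upwards [eventually_ge_atTop (1 + 4 * |e| + 2 * |A|)] with κ hκ
  have he := abs_nonneg e
  have hA := abs_nonneg A
  have hκ1 : 1 ≤ κ := by linarith
  have hκ0 : 0 < κ := by linarith
  have ht : 1 + 4 * |e| + 2 * |A| ≤ κ ^ 2 := hκ.trans (by nlinarith)
  have ht1 : 1 ≤ κ ^ 2 := by nlinarith
  refine (pow_le_pow_iff_left₀ (by positivity) (hD κ hκ0).le two_ne_zero).1 ?_
  have h1 := neg_abs_le e
  have h2 := neg_abs_le A
  have h3 : 0 ≤ 3 * (κ ^ 2) ^ 2 + 12 * e * κ ^ 2 + 4 * A := by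
    generalize κ ^ 2 = t at *
    nlinarith [mul_nonneg (by linarith : (0 : ℝ) ≤ t - 1) hA,
      mul_nonneg (by linarith : (0 : ℝ) ≤ t) (by linarith : 0 ≤ t - (4 * |e| + 2 * |A|)),
      mul_nonneg (by linarith : (0 : ℝ) ≤ t) (by linarith : 0 ≤ e + |e|)]
  rw [hsq κ hκ0]
  nlinarith [mul_nonneg (sq_nonneg κ) h3]

/-- The difference is $(2\kappa^3+3e\kappa-D)/(2\kappa D)$. After rationalizing, the numerator is
$(2\kappa^3+3e\kappa)^2-D^2=(9e^2-4A)\kappa^2$: the shift $\frac32e$ cancels the $\kappa^4$ terms as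
well as the $\kappa^6$ terms, and the quotient has order $\kappa^{2-7}$. -/
theorem isBigO_coeff_zero : (fun κ : ℝ => (κ ^ 2 + 3 / 2 * e) / D κ - 1 / (2 * κ)) =O[atTop]
    fun κ : ℝ => κ ^ (-5 : ℤ) := by
  refine IsBigO.of_bound |9 * e ^ 2 - 4 * A| ?_
  filter_upwards [eventually_cube_le hD hsq, eventually_ge_atTop (1 + 2 * |e|)] with κ h3 hκ
  have he := abs_nonneg e
  have hκ0 : 0 < κ := by linarith
  have hDp := hD κ hκ0
  have hnn : 0 ≤ 2 * κ ^ 3 + 3 * e * κ := by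
    have h1 := neg_abs_le e
    have h2 : 0 ≤ 2 * κ ^ 2 + 3 * e := by nlinarith
    nlinarith
  have hpos : 0 < 2 * κ * D κ * (2 * κ ^ 3 + 3 * e * κ + D κ) := by positivity
  have e1 : (κ ^ 2 + 3 / 2 * e) / D κ - 1 / (2 * κ) =
      (9 * e ^ 2 - 4 * A) * κ ^ 2 / (2 * κ * D κ * (2 * κ ^ 3 + 3 * e * κ + D κ)) := by
    have hne : 2 * κ ^ 3 + 3 * e * κ + D κ ≠ 0 := by positivity
    rw [eq_div_iff hpos.ne']
    field_simp
    linear_combination (-1) * hsq κ hκ0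
  rw [e1, norm_div, norm_mul, Real.norm_eq_abs, Real.norm_of_nonneg (by positivity : 0 ≤ κ ^ 2),
    Real.norm_of_nonneg hpos.le, Real.norm_of_nonneg (by positivity), div_le_iff₀ hpos, mul_assoc]
  refine mul_le_mul_of_nonneg_left ?_ (abs_nonneg _)
  rw [zpow_neg, show (κ ^ (5 : ℤ)) = κ ^ 5 by norm_cast, inv_mul_eq_div, le_div_iff₀ (by positivity)]
  calc κ ^ 2 * κ ^ 5 = κ * κ ^ 3 * κ ^ 3 := by ring
    _ ≤ 2 * κ * D κ * (2 * κ ^ 3 + 3 * e * κ + D κ) := by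
      gcongr <;> linarith

/-- Rationalizing $(D-2\kappa^3)/(4\kappa^3D)$ leaves the numerator $D^2-4\kappa^6$, of order
$\kappa^4$, over a denominator of order $\kappa^9$. -/
theorem isBigO_coeff_one : (fun κ : ℝ => -1 / (2 * D κ) - -1 / (4 * κ ^ 3)) =O[atTop]
    fun κ : ℝ => κ ^ (-5 : ℤ) := by
  refine IsBigO.of_bound (12 * |e| + 4 * |A|) ?_
  filter_upwards [eventually_cube_le hD hsq, eventually_ge_atTop 1] with κ h3 hκ
  have hκ0 : 0 < κ := by linarith
  have hDp := hD κ hκ0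
  have hpos : 0 < 4 * κ ^ 3 * D κ * (D κ + 2 * κ ^ 3) := by positivity
  have e1 : -1 / (2 * D κ) - -1 / (4 * κ ^ 3) =
      (12 * e * κ ^ 4 + 4 * A * κ ^ 2) / (4 * κ ^ 3 * D κ * (D κ + 2 * κ ^ 3)) := by
    rw [eq_div_iff hpos.ne']
    field_simp
    linear_combination 2 * hsq κ hκ0
  have e2 : |12 * e * κ ^ 4 + 4 * A * κ ^ 2| ≤ (12 * |e| + 4 * |A|) * κ ^ 4 := by
    refine (abs_add_le _ _).trans ?_
    simp only [abs_mul, abs_pow, abs_of_pos hκ0, Nat.abs_ofNat]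
    have : κ ^ 2 ≤ κ ^ 4 := pow_le_pow_right₀ hκ (by norm_num)
    nlinarith [abs_nonneg A]
  rw [e1, norm_div, Real.norm_eq_abs, Real.norm_of_nonneg hpos.le,
    Real.norm_of_nonneg (by positivity), div_le_iff₀ hpos]
  refine e2.trans ?_
  rw [mul_assoc]
  refine mul_le_mul_of_nonneg_left ?_ (by positivity)
  rw [zpow_neg, show (κ ^ (5 : ℤ)) = κ ^ 5 by norm_cast, inv_mul_eq_div, le_div_iff₀ (by positivity)]
  calc κ ^ 4 * κ ^ 5 = 1 * κ ^ 3 * κ ^ 3 * κ ^ 3 := by ring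
    _ ≤ 4 * κ ^ 3 * D κ * (D κ + 2 * κ ^ 3) := by
      gcongr
      · norm_num
      · linarith [pow_pos hκ0 3]

end Asymptotics

/-! ### Rectangular lattices -/

namespace PeriodPair

open ComplexConjugate

variable {L : PeriodPair} {ω₁ η₃ : ℝ} (hL₁ : L.ω₁ = 2 * (ω₁ : ℂ))
  (hL₃ : L.ω₂ = 2 * ((η₃ : ℂ) * Complex.I))
include hL₁ hL₃

theorem conj_mem_lattice_of_rectangular (z : ℂ) (hz : z ∈ L.lattice) : conj z ∈ L.lattice := by
  obtain ⟨m, n, rfl⟩ := mem_lattice.1 hz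
  refine mem_lattice.2 ⟨m, -n, ?_⟩
  simp only [hL₁, hL₃, map_add, map_mul, map_intCast, map_ofNat, Complex.conj_ofReal,
    Complex.conj_I]
  push_cast
  ring

theorem ofReal_notMem_lattice_of_rectangular {x : ℝ} (hx : x ∈ Ioo 0 (2 * ω₁)) :
    (x : ℂ) ∉ L.lattice := by
  intro hmem
  obtain ⟨m, n, e⟩ := mem_lattice.1 hmem
  have hre := congrArg Complex.re e
  simp [hL₁, hL₃] at hre
  have hω : 0 < 2 * ω₁ := hx.1.trans hx.2
  rw [← hre] at hx
  have h0 : (0 : ℝ) < m := pos_of_mul_pos_left hx.1 hω.le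
  have h1 : (m : ℝ) < 1 := by nlinarith [hx.2]
  norm_cast at h0 h1
  omega

theorem ofReal_add_notMem_lattice_of_rectangular (hη₃ : 0 < η₃) (x : ℝ) :
    (x : ℂ) + η₃ * Complex.I ∉ L.lattice := by
  intro hmem
  obtain ⟨m, n, e⟩ := mem_lattice.1 hmem
  have him := congrArg Complex.im e
  simp [hL₁, hL₃] at him
  have h1 : (2 * n - 1 : ℝ) = 0 := by
    have : (2 * n - 1) * η₃ = 0 := by linear_combination him
    exact (mul_eq_zero.1 this).resolve_right hη₃.ne'
  have h2 : (2 * n : ℤ) = 1 := by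
    have : (2 * n : ℝ) = 1 := by linarith
    exact_mod_cast this
  omega

theorem ofReal_re_weierstrassP_real (x : ℝ) :
    ((L.weierstrassP x).re : ℂ) = L.weierstrassP x := by
  simpa using ofReal_re_weierstrassP (conj_mem_lattice_of_rectangular hL₁ hL₃)
    (a := 0) (by simp) x

theorem ofReal_re_derivWeierstrassP_real (x : ℝ) :
    ((L.derivWeierstrassP x).re : ℂ) = L.derivWeierstrassP x := by
  simpa using ofReal_re_derivWeierstrassP (conj_mem_lattice_of_rectangular hL₁ hL₃)
    (a := 0) (by simp) x

omit hL₁ in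
theorem conj_sub_mem_lattice_of_rectangular :
    conj ((η₃ : ℂ) * Complex.I) - (η₃ : ℂ) * Complex.I ∈ L.lattice := by
  refine mem_lattice.2 ⟨0, -1, ?_⟩
  simp only [hL₃, map_mul, Complex.conj_ofReal, Complex.conj_I]
  push_cast
  ring

theorem ofReal_re_weierstrassP_line (x : ℝ) :
    ((L.weierstrassP (x + η₃ * Complex.I)).re : ℂ) = L.weierstrassP (x + η₃ * Complex.I) :=
  ofReal_re_weierstrassP (conj_mem_lattice_of_rectangular hL₁ hL₃)
    (conj_sub_mem_lattice_of_rectangular hL₃) x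

theorem realWeierstrass_of_rectangular (hω₁ : 0 < ω₁) (hη₃ : 0 < η₃) :
    RealWeierstrass ω₁ L.g₂.re L.g₃.re (fun x => (L.weierstrassP x).re)
      (fun x => (L.derivWeierstrassP x).re) (fun x => (L.weierstrassP (x + η₃ * Complex.I)).re)
      (fun x => (L.derivWeierstrassP (x + η₃ * Complex.I)).re) := by
  have hc := conj_mem_lattice_of_rectangular hL₁ hL₃
  have h0 : conj (0 : ℂ) - 0 ∈ L.lattice := by simp
  have hI := conj_sub_mem_lattice_of_rectangular hL₃
  have m₀ : ∀ x ∈ Ioo 0 (2 * ω₁), (x : ℂ) + 0 ∉ L.lattice := fun x hx => by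
    rw [add_zero]; exact ofReal_notMem_lattice_of_rectangular hL₁ hL₃ hx
  have m₁ := ofReal_add_notMem_lattice_of_rectangular hL₁ hL₃ hη₃
  refine ⟨hω₁, fun x hx => ?_, fun x hx => ?_, fun x hx => ?_, L.tendsto_re_weierstrassP_atTop, ?_,
    fun x => hasDerivAt_re_weierstrassP (m₁ x),
    fun x => hasDerivAt_re_derivWeierstrassP hc hI (m₁ x),
    fun x => re_derivWeierstrassP_sq hc hI (m₁ x), fun x => ?_⟩
  · simpa using hasDerivAt_re_weierstrassP (m₀ x hx)
  · simpa using hasDerivAt_re_derivWeierstrassP hc h0 (m₀ x hx)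
  · simpa using re_derivWeierstrassP_sq hc h0 (m₀ x hx)
  -- $\wp'$ is odd and $2\omega_1$-periodic, so $\wp'(\omega_1)=-\wp'(-\omega_1)=-\wp'(\omega_1)$.
  · have h1 : L.derivWeierstrassP ω₁ = -L.derivWeierstrassP ω₁ := by
      conv_rhs => rw [← L.derivWeierstrassP_neg, ← L.derivWeierstrassP_add_coe _ ⟨_, L.ω₁_mem_lattice⟩]
      congr 1
      simp only [hL₁]
      ring
    simp [CharZero.eq_neg_self_iff.1 h1]
  · have := L.weierstrassP_add_coe (x + η₃ * Complex.I) ⟨_, L.ω₁_mem_lattice⟩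
    simp only [hL₁] at this
    rw [← this]
    push_cast
    ring_nf

end PeriodPair

/-! ### The traveling wave, its Green's function and the asymptotics. -/

theorem mainTheorem5 (L : PeriodPair) (ω₁ η₃ : ℝ) (hω₁ : 0 < ω₁) (hη₃ : 0 < η₃)
    (hL₁ : L.ω₁ = 2 * (ω₁ : ℂ)) (hL₃ : L.ω₂ = 2 * ((η₃ : ℂ) * Complex.I)) :
    -- the wave is real-valued, and its profile is smooth and `2ω₁`-periodic
    (∀ t x : ℝ, (cnoidalWave L t x : ℂ) = cnoidalExpr L t x) ∧
    ContDiff ℝ ∞ (cnoidalWave L 0) ∧ Function.Periodic (cnoidalWave L 0) (2 * ω₁) ∧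
    ∃ b ν c₁ c₂ : ℝ → ℝ,
      -- `b(κ)` is the only solution of `κ² = ℘(b) - ℘(ω₁)` in `(0, ω₁)`
      (∀ κ : ℝ, 0 < κ → b κ ∈ Ioo 0 ω₁ ∧
        (κ : ℂ) ^ 2 = L.weierstrassP (b κ) - L.weierstrassP ω₁ ∧
        (∀ b' ∈ Ioo 0 ω₁, (κ : ℂ) ^ 2 = L.weierstrassP (b' : ℝ) - L.weierstrassP ω₁ → b' = b κ) ∧
        L.derivWeierstrassP (b κ) ≠ 0) ∧
      -- the propagation speed and the two coefficients
      (∀ κ : ℝ, 0 < κ →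
        (ν κ : ℂ) = 8 * (κ : ℂ) ^ 5 / L.derivWeierstrassP (b κ) + 4 * (κ : ℂ) ^ 2 ∧
        (c₁ κ : ℂ) = (L.weierstrassP (b κ) + L.weierstrassP ω₁ / 2)
          / (-L.derivWeierstrassP (b κ)) ∧
        (c₂ κ : ℂ) = 1 / (2 * L.derivWeierstrassP (b κ))) ∧
      -- the traveling wave solves the `H_κ` flow
      (∀ κ : ℝ, 0 < κ →
        IsHKappaSolution κ (fun t x => cnoidalWave L 0 (x + ν κ * t))) ∧
      -- the diagonal Green's function along the flow
      (∀ κ : ℝ, 0 < κ → ∀ t : ℝ,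
        IsDiagonalGreen κ (fun x => cnoidalWave L 0 (x + ν κ * t))
          (fun x => c₁ κ + c₂ κ * cnoidalWave L 0 (x + ν κ * t))) ∧
      -- the asymptotics of the coefficients
      ((fun κ : ℝ => c₁ κ - 1 / (2 * κ)) =O[atTop] fun κ : ℝ => κ ^ (-5 : ℤ)) ∧
      ((fun κ : ℝ => c₂ κ - (-1 / (4 * κ ^ 3))) =O[atTop] fun κ : ℝ => κ ^ (-5 : ℤ)) := by
  have hR := L.realWeierstrass_of_rectangular hL₁ hL₃ hω₁ hη₃
  have hy := L.ofReal_re_weierstrassP_real hL₁ hL₃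
  have hy' := L.ofReal_re_derivWeierstrassP_real hL₁ hL₃
  have hp := L.ofReal_re_weierstrassP_line hL₁ hL₃
  have half₁ : L.ω₁ / 2 = (ω₁ : ℂ) := by rw [hL₁]; ring
  have half₃ : L.ω₂ / 2 = (η₃ : ℂ) * Complex.I := by rw [hL₃]; ring
  -- From here on the restrictions of $\wp$ and $\wp'$ are opaque real functions, known only through
  -- `RealWeierstrass` and the casts back to $\mathbb C$.
  generalize hyd : (fun x : ℝ => (L.weierstrassP x).re) = y at hR
  generalize hyd' : (fun x : ℝ => (L.derivWeierstrassP x).re) = y' at hR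
  generalize hpd : (fun x : ℝ => (L.weierstrassP (x + η₃ * Complex.I)).re) = p at hR
  generalize (fun x : ℝ => (L.derivWeierstrassP (x + η₃ * Complex.I)).re) = p' at hR
  replace hy : ∀ x : ℝ, L.weierstrassP x = (y x : ℂ) := fun x => by rw [← hyd]; exact (hy x).symm
  replace hy' : ∀ x : ℝ, L.derivWeierstrassP x = (y' x : ℂ) := fun x => by
    rw [← hyd']; exact (hy' x).symm
  replace hp : ∀ x : ℝ, L.weierstrassP (x + η₃ * Complex.I) = (p x : ℂ) := fun x => by
    rw [← hpd]; exact (hp x).symm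
  have expr : ∀ t x : ℝ, cnoidalExpr L t x = ((2 * p (x + 6 * y ω₁ * t) + y ω₁ : ℝ) : ℂ) := by
    intro t x
    have h := hp (x + 6 * y ω₁ * t)
    rw [cnoidalExpr, half₁, half₃, hy]
    push_cast at h ⊢
    rw [h]
  have wave : ∀ t x : ℝ, cnoidalWave L t x = 2 * p (x + 6 * y ω₁ * t) + y ω₁ := fun t x => by
    rw [cnoidalWave, expr, Complex.ofReal_re]
  have wave₀ : cnoidalWave L 0 = fun x => 2 * p x + y ω₁ := funext fun x => by
    rw [wave, mul_zero, add_zero]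
  have smooth : ContDiff ℝ ∞ fun x => 2 * p x + y ω₁ :=
    (contDiff_const.mul hR.contDiff_p).add contDiff_const
  refine ⟨fun t x => by rw [wave, expr], wave₀ ▸ smooth, fun x => ?_, ?_⟩
  · simp only [wave₀, hR.periodic x]
  -- The positivity of $\kappa$ sits inside the existential so that $b$ can be chosen as a function
  -- on all of $\mathbb R$; its value $0$ for $\kappa\le0$ is never used.
  have hb : ∀ κ : ℝ, ∃ b, 0 < κ → b ∈ Ioo 0 ω₁ ∧ y b = y ω₁ + κ ^ 2 ∧
      ∀ b' ∈ Ioo 0 ω₁, y b' = y ω₁ + κ ^ 2 → b' = b := fun κ => by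
    by_cases hκ : 0 < κ
    · obtain ⟨b, h⟩ := hR.existsUnique_eq (c := y ω₁ + κ ^ 2) (by linarith [pow_pos hκ 2])
      exact ⟨b, fun _ => h⟩
    · exact ⟨0, fun h => absurd h hκ⟩
  choose b hb using hb
  have hneg : ∀ κ : ℝ, 0 < κ → y' (b κ) < 0 := fun κ hκ => hR.y'_neg _ (hb κ hκ).1
  have green : ∀ κ : ℝ, 0 < κ → ∀ s : ℝ, IsDiagonalGreen κ (fun x => 2 * p (x + s) + y ω₁)
      (fun x => (y (b κ) + y ω₁ / 2) / (-y' (b κ)) +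
        1 / (2 * y' (b κ)) * (2 * p (x + s) + y ω₁)) := fun κ hκ s => by
    have h := ((hR.isGreenProfile hκ (hb κ hκ).1 (hb κ hκ).2.1).comp_add_const s)
    have cont : Continuous fun x => 2 * p (x + s) + y ω₁ :=
      smooth.continuous.comp (continuous_id.add continuous_const)
    have bdd : ∃ C, ∀ x, |2 * p (x + s) + y ω₁| ≤ C := by
      obtain ⟨C, hC⟩ := hR.exists_abs_p_le
      refine ⟨2 * C + |y ω₁|, fun x => (abs_add_le _ _).trans ?_⟩
      rw [abs_mul, Nat.abs_ofNat]
      linarith [hC (x + s)]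
    -- The identity $c_1+c_2(2p+e)=(p-\wp(b))/\wp'(b)$: the two terms $\pm e/(2\wp'(b))$ cancel.
    convert h.isDiagonalGreen cont bdd using 2 with x
    have := (hneg κ hκ).ne
    field_simp
    ring
  refine ⟨b, fun κ => 8 * κ ^ 5 / y' (b κ) + 4 * κ ^ 2,
    fun κ => (y (b κ) + y ω₁ / 2) / (-y' (b κ)), fun κ => 1 / (2 * y' (b κ)), ?_, ?_, ?_, ?_, ?_, ?_⟩
  · intro κ hκ
    obtain ⟨h1, h2, h3⟩ := hb κ hκ
    refine ⟨h1, ?_, fun b' hb' e => h3 b' hb' ?_, ?_⟩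
    · rw [hy, hy, h2]
      push_cast
      ring
    · rw [hy, hy] at e
      have e' : κ ^ 2 = y b' - y ω₁ := by exact_mod_cast e
      linarith
    · rw [hy']
      exact_mod_cast (hneg κ hκ).ne
  · intro κ hκ
    rw [hy, hy, hy']
    push_cast
    exact ⟨rfl, rfl, rfl⟩
  · intro κ hκ
    simp only [wave₀]
    refine ⟨?_, fun T => ?_, fun t => ⟨_, green κ hκ _, ?_, fun x => ?_⟩⟩
    · exact (smooth.of_le (by simp)).comp (contDiff_snd.add (contDiff_const.mul contDiff_fst))
    · obtain ⟨C, hC⟩ := hR.exists_abs_p_le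
      refine ⟨2 * C + |y ω₁|, fun t _ x => (abs_add_le _ _).trans ?_⟩
      rw [abs_mul, Nat.abs_ofNat]
      linarith [hC (x + (8 * κ ^ 5 / y' (b κ) + 4 * κ ^ 2) * t)]
    · exact contDiff_const.add (contDiff_const.mul
        ((smooth.of_le (by simp)).comp (contDiff_id.add contDiff_const)))
    · have d₁ : ∀ s x : ℝ, HasDerivAt (fun x => 2 * p (x + s) + y ω₁) (2 * p' (x + s)) x :=
        fun s x => (((hR.hasDerivAt_p (x + s)).comp_add_const x s).const_mul 2).add_const _
      have d₂ : HasDerivAt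
          (fun t => 2 * p (x + (8 * κ ^ 5 / y' (b κ) + 4 * κ ^ 2) * t) + y ω₁)
          (2 * (p' (x + (8 * κ ^ 5 / y' (b κ) + 4 * κ ^ 2) * t) *
            (8 * κ ^ 5 / y' (b κ) + 4 * κ ^ 2))) t := by
        have h1 : HasDerivAt (fun t => x + (8 * κ ^ 5 / y' (b κ) + 4 * κ ^ 2) * t)
            (8 * κ ^ 5 / y' (b κ) + 4 * κ ^ 2) t := by
          simpa using ((hasDerivAt_id t).const_mul
            (8 * κ ^ 5 / y' (b κ) + 4 * κ ^ 2)).const_add x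
        exact (((hR.hasDerivAt_p _).comp t h1).const_mul 2).add_const _
      -- Both sides are multiples of $V'$, and $16\kappa^5c_2+4\kappa^2=\nu$ because
      -- $c_2=1/(2\wp'(b))$.
      refine d₂.congr_deriv ?_
      rw [(d₁ _ x).deriv, (((d₁ _ x).const_mul _).const_add _).deriv]
      have := (hneg κ hκ).ne
      field_simp
      ring
  · intro κ hκ t
    simp only [wave₀]
    exact green κ hκ _
  all_goals
    -- The asymptotic lemmas apply with $D=-\wp'(b)$ and $A=3e^2-g_2/4$; there
    -- $\wp(b)+\frac12e=\kappa^2+\frac32e$.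
    have hD : ∀ κ : ℝ, 0 < κ → 0 < -y' (b κ) := fun κ hκ => neg_pos.2 (hneg κ hκ)
    have hsq : ∀ κ : ℝ, 0 < κ → (-y' (b κ)) ^ 2 =
        4 * κ ^ 2 * (κ ^ 4 + 3 * y ω₁ * κ ^ 2 + (3 * y ω₁ ^ 2 - L.g₂.re / 4)) := fun κ hκ => by
      rw [neg_sq]
      exact hR.y'_sq_eq (hb κ hκ).1 (hb κ hκ).2.1
  · refine (isBigO_coeff_zero hD hsq).congr' ?_ EventuallyEq.rfl
    filter_upwards [eventually_gt_atTop 0] with κ hκ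
    rw [(hb κ hκ).2.1]
    ring
  · refine (isBigO_coeff_one hD hsq).congr' (Eventually.of_forall fun κ => ?_) EventuallyEq.rfl
    simp only [mul_neg, neg_div_neg_eq]
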